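/- **Setting.** Let $\Omega_h=\bigcup_{K\in\mathcal T_h}K\subset\mathbb R^3$ be partitioned into finitely many convex polytopes $K$ with non-empty, pairwise disjoint interiors, and let $\Omega$ be the interior of $\Omega_h$. Let $\mathcal E_h$ be the set of interior faces $e=K_1\cap K_2$ (of positive area), each with a unit normal $n=n_1$ pointing from $K_1$ to $K_2$, $n_2=-n_1$. For scalar functions $\llbracket g\rrbracket=g_1n_1+g_2n_2$, for vector fields $\llbracket g\rrbracket=g_1-g_2$, and $\{g\}=\frac12(g_1+g_2)$. Let $P_k(K)$ be the polynomials of degree at most $k$, $k\ge0$, and - $DG_k=\{f\in L^2(\Omega): f|_K\in P_k(K)\ \forall K\}$, - $\mathring Q_k=\{f\in H^1(\Omega): f|_K\in P_k(K)\ \forall K,\ f=0\text{ on }\partial\Omega\}$, - $RT_k=\{f\in H(\mathrm{div},\Omega): f|_K\in P_k(K)^3+xP_k(K)\ \forall K\}$, and $\mathring{RT}_k=\{f\in RT_k: n\cdot f=0\text{ on }\partial\Omega\}$, - $\mathring N_k=\{f\in H(\mathrm{curl},\Omega): f|_K\in P_k(K)^3+x\times P_k(K)^3\ \forall K,\ n\times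 f=0\text{ on }\partial\Omega\}$, the boundary conditions being understood in the weak sense (Green's formula without boundary term against smooth compactly supported functions on $\mathbb R^3$). For $E\in\mathring N_k$ let $\nabla_w\cdot E\in\mathring Q_{k+1}$ be defined by $\int_\Omega(\nabla_w\cdot E)\,\phi=-\int_\Omega E\cdot\nabla\phi$ for all $\phi\in\mathring Q_{k+1}$. Let $m,c>0$, $e\in\mathbb R$, let $w_1,\dots,w_N\in\mathbb R$ be constant particle weights, $\gamma(u)=\sqrt{1+u\cdot u/(m^2c^2)}$, and let $T\ge 0$. **Scheme.** Let $\rho_h(t)\in DG_{k+1}$ (nowhere zero on the closed cells), $M_h(t)\in RT_k$, $E_h(t)\in\mathring N_k$, $B_h(t)\in\mathring{RT}_k$, $X_p(t)\in\Omega_h$, $U_p(t)\in\mathbb R^3$ ($1\le p\le N$, $t\in[0,T]$) be absolutely continuous in time. Put $$w_h=\overline{\frac{M_h}{\rho_h\,\gamma(mM_h/\rho_h)}},\qquad P_h=\overline{\gamma(mM_h/\rho_h)-1-\frac{M_h^2}{c^2\rho_h^2\,\gamma(mM_h/\rho_h)}},$$ where the bars are the $L^2$-projections onto $RT_k$ and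 onto $DG_{k+1}$, respectively. For a piecewise polynomial vector field $a$ on a face let $a^*=\{a\}+\frac12\frac{M_h\cdot n}{|M_h\cdot n|}\llbracket a\rrbracket$ (with $a^*=\{a\}$ where $M_h\cdot n=0$). Assume that for almost every $t\in[0,T]$ (differential operators being taken cell by cell) $$\int_{\Omega_h}\partial_t\rho_h\,\phi_h=\int_{\Omega_h}\rho_hw_h\cdot\nabla\phi_h-\sum_{e\in\mathcal E_h}\int_e(\rho_hw_h)^*\cdot\llbracket\phi_h\rrbracket\qquad\forall\phi_h\in DG_{k+1},$$ $$\begin{aligned}\int_{\Omega_h}\partial_tM_h\cdot\mu_h={}&\int_{\Omega_h}(w_h\cdot\nabla\mu_h-\mu_h\cdot\nabla w_h)\cdot M_h-c^2\int_{\Omega_h}\rho_h\,\mu_h\cdot\nabla P_h+\frac em\int_{\Omega_h}\rho_h\Big(E_h+w_h\times\frac{B_h}c\Big)\cdot\mu_h\\&+\sum_{e\in\mathcal E_h}\int_e(n\times M_h)^*\cdot\llbracket\mu_h\times w_h\rrbracket+c^2\sum_{e\in\mathcal E_h}\int_e(\rho_h\mu_h)^*\cdot\llbracket P_h\rrbracket\qquad\forall\mu_h\in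 RT_k,\end{aligned}$$ $$\int_{\Omega_h}\partial_tE_h\cdot\nu_h=c\int_{\Omega_h}B_h\cdot(\nabla\times\nu_h)-\frac{4\pi e}m\int_{\Omega_h}\rho_hw_h\cdot\nu_h-\frac{4\pi e}m\sum_{p=1}^N\frac{w_pU_p}{\gamma(U_p)}\cdot\nu_h(X_p)\qquad\forall\nu_h\in\mathring N_k,$$ $$\int_{\Omega_h}\partial_tB_h\cdot\tau_h=-c\int_{\Omega_h}\tau_h\cdot(\nabla\times E_h)\qquad\forall\tau_h\in\mathring{RT}_k,$$ $$\dot X_p=\frac{U_p}{m\gamma(U_p)},\qquad\dot U_p=e\Big(E_h(X_p)+\frac{U_p\times B_h(X_p)}{cm\gamma(U_p)}\Big),\qquad 1\le p\le N,$$ where a piecewise polynomial is evaluated at $X_p(t)$ by its restriction to a cell containing $X_p(t)$, for each particle and time the same cell in all equations. **Proposition.** The following are constant in time on $[0,T]$: 1. the total fluid mass $\int_{\Omega_h}\rho_h\,dx$; 2. the total particle mass: all particles are in $\Omega_h$ and the total weight in $\Omega_h$ is $\sum_pw_p$ at all times; 3. the total energy $\int_{\Omega_h}\rho_h(\gamma(mM_h/\rho_h)-1)c^2\,dx+\sum_pw_p(\gamma(U_p)-1)mc^2+\frac1{8\pi}\int_{\Omega_h}(E_h^2+B_h^2)\,dx$;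 4. for every $\phi_h\in\mathring Q_{k+1}$ the weak Gauss functional $\int_{\Omega_h}\big[\nabla_w\cdot E_h-4\pi e\big(\frac{\rho_h}m+\sum_pw_p\,\delta(x-X_p)\big)\big]\phi_h\,dx$, where $\nabla_w\cdot E_h$ exists and is unique; 5. the divergence $\nabla\cdot B_h$ (on each cell, and as the weak divergence in $\Omega$). Moreover, at every time $t\in[0,T]$ the flux terms vanish or cancel for the test functions of mass and energy conservation: the density flux vanishes for $\phi_h=1$; $\sum_e\int_e(n\times M_h)^*\cdot\llbracket\mu_h\times w_h\rrbracket=0$ for $\mu_h=w_h$; and for $\phi_h=c^2P_h$, $\mu_h=w_h$ the density flux term cancels the second momentum flux term: $-\sum_e\int_e(\rho_hw_h)^*\cdot\llbracket c^2P_h\rrbracket+c^2\sum_e\int_e(\rho_hw_h)^*\cdot\llbracket P_h\rrbracket=0$. -/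

import Mathlib

open MeasureTheory Set
open scoped ContDiff Matrix

noncomputable section

namespace HybridFluid

/-- Physical space `ℝ³` with its Euclidean structure. -/
abbrev Space := EuclideanSpace ℝ (Fin 3)

/-- A partition `𝒯_h` into finitely many convex polytopes with non-empty, pairwise disjoint
interiors. -/
structure Mesh where
  /-- number of cells -/
  n : ℕ
  /-- the closed cells `K` -/
  cell : Fin n → Set Space
  polytope : ∀ i, ∃ s : Finset Space, cell i = convexHull ℝ (s : Set Space)
  interior_nonempty : ∀ i, (interior (cell i)).Nonempty
  disjoint_interior : ∀ i j, i ≠ j → Disjoint (interior (cell i)) (interior (cell j))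

/-- A piecewise polynomial scalar function: one polynomial on each cell. Its value on a cell,
including the boundary of the cell (the one-sided trace), is the value of that polynomial. -/
abbrev ScalarField (𝒯 : Mesh) := Fin 𝒯.n → MvPolynomial (Fin 3) ℝ

/-- A piecewise polynomial vector field: three polynomials on each cell. -/
abbrev VectorField (𝒯 : Mesh) := Fin 𝒯.n → Fin 3 → MvPolynomial (Fin 3) ℝ

/-- Value of a polynomial at a point. -/
def ev (p : MvPolynomial (Fin 3) ℝ) (x : Space) : ℝ := MvPolynomial.eval (fun i => x i) p

/-- Value of a vector of polynomials at a point. -/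
def evV (v : Fin 3 → MvPolynomial (Fin 3) ℝ) (x : Space) : Fin 3 → ℝ := fun i => ev (v i) x

/-! ### Differential operators on a cell -/

/-- `∇p` -/
def grad (p : MvPolynomial (Fin 3) ℝ) : Fin 3 → MvPolynomial (Fin 3) ℝ :=
  fun i => MvPolynomial.pderiv i p

/-- `∇ · v` -/
def div (v : Fin 3 → MvPolynomial (Fin 3) ℝ) : MvPolynomial (Fin 3) ℝ :=
  ∑ i, MvPolynomial.pderiv i (v i)

/-- `∇ × v` -/
def curl (v : Fin 3 → MvPolynomial (Fin 3) ℝ) : Fin 3 → MvPolynomial (Fin 3) ℝ :=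
  ![MvPolynomial.pderiv 1 (v 2) - MvPolynomial.pderiv 2 (v 1),
    MvPolynomial.pderiv 2 (v 0) - MvPolynomial.pderiv 0 (v 2),
    MvPolynomial.pderiv 0 (v 1) - MvPolynomial.pderiv 1 (v 0)]

/-- `v · ∇u`, with `j`-th component `∑ i, v i * ∂ᵢ (u j)` -/
def advect (v u : Fin 3 → MvPolynomial (Fin 3) ℝ) : Fin 3 → MvPolynomial (Fin 3) ℝ :=
  fun j => ∑ i, v i * MvPolynomial.pderiv i (u j)

/-- The coordinate field `x`. -/
def posField : Fin 3 → MvPolynomial (Fin 3) ℝ := fun i => MvPolynomial.X i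

/-! ### Test functions -/

/-- Smooth compactly supported functions on `ℝ³`. -/
def IsTest (ψ : Space → ℝ) : Prop := ContDiff ℝ ∞ ψ ∧ HasCompactSupport ψ

/-- Partial derivative `∂ᵢ ψ`. -/
def partialD (i : Fin 3) (ψ : Space → ℝ) (x : Space) : ℝ :=
  fderiv ℝ ψ x (EuclideanSpace.single i 1)

/-- `∇ψ` -/
def gradT (ψ : Space → ℝ) (x : Space) : Fin 3 → ℝ := fun i => partialD i ψ x

/-- `∇ × ψ` -/
def curlT (ψ : Fin 3 → Space → ℝ) (x : Space) : Fin 3 → ℝ :=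
  ![partialD 1 (ψ 2) x - partialD 2 (ψ 1) x,
    partialD 2 (ψ 0) x - partialD 0 (ψ 2) x,
    partialD 0 (ψ 1) x - partialD 1 (ψ 0) x]

namespace Mesh

variable (𝒯 : Mesh)

/-- The discrete domain `Ω_h`, the union of the cells. -/
def domain : Set Space := ⋃ i, 𝒯.cell i

/-- The integral over `Ω_h` of a function given cell by cell. -/
def integral (F : Fin 𝒯.n → Space → ℝ) : ℝ := ∑ i, ∫ x in 𝒯.cell i, F i x

/-! ### Sobolev conditions for piecewise polynomials

The domain `Ω` is the interior of `Ω_h`. The homogeneous boundary conditions are imposed in the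
weak sense: Green's formula holds without a boundary term against all test functions of `ℝ³`. -/

/-- `g ∈ L²(Ω)` is the weak divergence of `f` in `Ω`. -/
def HasWeakDivergence (f : VectorField 𝒯) (g : Space → ℝ) : Prop :=
  MemLp g 2 (volume.restrict 𝒯.domain) ∧
    ∀ ψ : Space → ℝ, IsTest ψ → tsupport ψ ⊆ interior 𝒯.domain →
      𝒯.integral (fun K x => evV (f K) x ⬝ᵥ gradT ψ x) = - ∫ x in 𝒯.domain, g x * ψ x

/-- `f ∈ H(div, Ω)` -/
def MemHdiv (f : VectorField 𝒯) : Prop := ∃ g, 𝒯.HasWeakDivergence f g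

/-- `f ∈ H(div, Ω)` with `n · f = 0` on `∂Ω` -/
def MemHdivZero (f : VectorField 𝒯) : Prop :=
  ∃ g : Space → ℝ, MemLp g 2 (volume.restrict 𝒯.domain) ∧
    ∀ ψ : Space → ℝ, IsTest ψ →
      𝒯.integral (fun K x => evV (f K) x ⬝ᵥ gradT ψ x) = - ∫ x in 𝒯.domain, g x * ψ x

/-- `f ∈ H(curl, Ω)` with `n × f = 0` on `∂Ω` -/
def MemHcurlZero (f : VectorField 𝒯) : Prop :=
  ∃ g : Fin 3 → Space → ℝ, (∀ i, MemLp (g i) 2 (volume.restrict 𝒯.domain)) ∧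
    ∀ ψ : Fin 3 → Space → ℝ, (∀ i, IsTest (ψ i)) →
      𝒯.integral (fun K x => evV (f K) x ⬝ᵥ curlT ψ x) = ∫ x in 𝒯.domain, ∑ i, g i x * ψ i x

/-- `f ∈ H¹(Ω)` with `f = 0` on `∂Ω` -/
def MemH1Zero (f : ScalarField 𝒯) : Prop :=
  ∃ g : Fin 3 → Space → ℝ, (∀ i, MemLp (g i) 2 (volume.restrict 𝒯.domain)) ∧
    ∀ ψ : Space → ℝ, IsTest ψ → ∀ i,
      𝒯.integral (fun K x => ev (f K) x * partialD i ψ x) = - ∫ x in 𝒯.domain, g i x * ψ x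

/-! ### Finite element spaces -/

/-- `DG_k` -/
def DG (k : ℕ) : Set (ScalarField 𝒯) := {f | ∀ K, (f K).totalDegree ≤ k}

/-- `Q_k` with vanishing boundary values -/
def QZero (k : ℕ) : Set (ScalarField 𝒯) :=
  {f | (∀ K, (f K).totalDegree ≤ k) ∧ 𝒯.MemH1Zero f}

/-- The local condition `f|_K ∈ P_k(K)³ + x P_k(K)`. -/
def IsLocalRT (k : ℕ) (f : VectorField 𝒯) : Prop :=
  ∀ K, ∃ (p : Fin 3 → MvPolynomial (Fin 3) ℝ) (q : MvPolynomial (Fin 3) ℝ),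
    (∀ i, (p i).totalDegree ≤ k) ∧ q.totalDegree ≤ k ∧ f K = p + q • posField

/-- `RT_k` -/
def RT (k : ℕ) : Set (VectorField 𝒯) := {f | 𝒯.IsLocalRT k f ∧ 𝒯.MemHdiv f}

/-- `RT_k` with vanishing normal component on the boundary -/
def RTZero (k : ℕ) : Set (VectorField 𝒯) := {f | 𝒯.IsLocalRT k f ∧ 𝒯.MemHdivZero f}

/-- `N_k` (`f|_K ∈ P_k(K)³ + x × P_k(K)³`) with vanishing tangential components on the
boundary -/
def NedZero (k : ℕ) : Set (VectorField 𝒯) :=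
  {f | (∀ K, ∃ p q : Fin 3 → MvPolynomial (Fin 3) ℝ,
      (∀ i, (p i).totalDegree ≤ k) ∧ (∀ i, (q i).totalDegree ≤ k) ∧
        f K = p + posField ⨯₃ q) ∧ 𝒯.MemHcurlZero f}

/-- `g` is the discrete weak divergence `∇_w · E`: the element of the space `Q_{k+1}` with zero
boundary values such that `∫ g φ = - ∫ E · ∇φ` for all `φ` in that space. -/
def IsWeakDiv (k : ℕ) (E : VectorField 𝒯) (g : ScalarField 𝒯) : Prop :=
  g ∈ 𝒯.QZero (k + 1) ∧ ∀ φ ∈ 𝒯.QZero (k + 1),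
    𝒯.integral (fun K x => ev (g K) x * ev (φ K) x) =
      - 𝒯.integral (fun K x => evV (E K) x ⬝ᵥ evV (grad (φ K)) x)

/-- `p` is the `L²`-projection onto `DG_k` of the function `v`, given cell by cell. -/
def IsProjDG (k : ℕ) (v : Fin 𝒯.n → Space → ℝ) (p : ScalarField 𝒯) : Prop :=
  p ∈ 𝒯.DG k ∧ ∀ φ ∈ 𝒯.DG k,
    𝒯.integral (fun K x => ev (p K) x * ev (φ K) x) = 𝒯.integral (fun K x => v K x * ev (φ K) x)

/-- `p` is the `L²`-projection onto `RT_k` of the field `v`, given cell by cell. -/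
def IsProjRT (k : ℕ) (v : Fin 𝒯.n → Space → Fin 3 → ℝ) (p : VectorField 𝒯) : Prop :=
  p ∈ 𝒯.RT k ∧ ∀ μ ∈ 𝒯.RT k,
    𝒯.integral (fun K x => evV (p K) x ⬝ᵥ evV (μ K) x) =
      𝒯.integral (fun K x => v K x ⬝ᵥ evV (μ K) x)

/-! ### Interior faces and fluxes -/

/-- `ν` is a unit vector separating the cell `i` from the cell `j` and pointing from `i` to `j`.
If `K_i ∩ K_j` has positive area, this determines `ν`. -/
def IsUnitNormal (i j : Fin 𝒯.n) (ν : Space) : Prop :=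
  ‖ν‖ = 1 ∧ ∃ a : ℝ, (∀ x ∈ 𝒯.cell i, inner ℝ ν x ≤ a) ∧ ∀ x ∈ 𝒯.cell j, a ≤ inner ℝ ν x

theorem exists_isUnitNormal {i j : Fin 𝒯.n} (hij : i ≠ j) : ∃ ν, 𝒯.IsUnitNormal i j ν := by
  have hconv : ∀ l, Convex ℝ (𝒯.cell l) := fun l => by
    obtain ⟨s, hs⟩ := 𝒯.polytope l
    rw [hs]; exact convex_convexHull ℝ _
  have hcl : ∀ l, 𝒯.cell l ⊆ closure (interior (𝒯.cell l)) := fun l => by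
    rw [(hconv l).closure_interior_eq_closure_of_nonempty_interior (𝒯.interior_nonempty l)]
    exact subset_closure
  obtain ⟨f, u, hf, hg⟩ := geometric_hahn_banach_open_open (hconv i).interior isOpen_interior
    (hconv j).interior isOpen_interior (𝒯.disjoint_interior i j hij)
  obtain ⟨a, ha⟩ := 𝒯.interior_nonempty i
  obtain ⟨b, hb⟩ := 𝒯.interior_nonempty j
  set v : Space := (InnerProductSpace.toDual ℝ Space).symm f with hv
  have hfv : ∀ x, inner ℝ v x = f x := fun x => by
    simp [hv, InnerProductSpace.toDual_symm_apply]
  have hv0 : v ≠ 0 := by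
    intro h0
    have h1 := hf a ha
    have h2 := hg b hb
    rw [← hfv, h0, inner_zero_left] at h1 h2
    linarith
  have hpos : 0 < ‖v‖⁻¹ := inv_pos.mpr (norm_pos_iff.mpr hv0)
  refine ⟨‖v‖⁻¹ • v, norm_smul_inv_norm hv0, ‖v‖⁻¹ * u, fun x hx => ?_, fun x hx => ?_⟩
  · rw [real_inner_smul_left, hfv]
    refine mul_le_mul_of_nonneg_left ?_ hpos.le
    exact closure_minimal (fun y hy => (hf y hy).le)
      (isClosed_le f.continuous continuous_const) (hcl i hx)
  · rw [real_inner_smul_left, hfv]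
    refine mul_le_mul_of_nonneg_left ?_ hpos.le
    exact closure_minimal (fun y hy => (hg y hy).le)
      (isClosed_le continuous_const f.continuous) (hcl j hx)

/-- The unit normal of the face `K_i ∩ K_j` pointing from `K_i` to `K_j`. -/
def normal (i j : Fin 𝒯.n) : Fin 3 → ℝ :=
  fun l => (Classical.epsilon (𝒯.IsUnitNormal i j) : Space) l

open Classical in
/-- The interior faces `K_i ∩ K_j`: the pairs of cells whose intersection has positive area. Each
face is listed once and oriented from `K_i` to `K_j` with `i < j`. -/
def interiorFaces : Finset (Fin 𝒯.n × Fin 𝒯.n) :=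
  Finset.univ.filter fun e => e.1 < e.2 ∧ 0 < (μHE[2] : Measure Space) (𝒯.cell e.1 ∩ 𝒯.cell e.2)

/-- Sum over the interior faces of surface integrals. -/
def faceSum (F : Fin 𝒯.n → Fin 𝒯.n → Space → ℝ) : ℝ :=
  ∑ e ∈ 𝒯.interiorFaces,
    ∫ x in 𝒯.cell e.1 ∩ 𝒯.cell e.2, F e.1 e.2 x ∂(μHE[2] : Measure Space)

/-- The upwind value `a^* = {a} + (1/2) (M · n / |M · n|) ⟦a⟧` at the point `x` of the face
`K_i ∩ K_j`, where `a` is a vector field given cell by cell (the factor `M · n / |M · n|` is `0`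
where `M · n = 0`; for `M ∈ H(div, Ω)` the average in `M · n` is the common value of both sides). -/
def upwind (M : VectorField 𝒯) (a : Fin 𝒯.n → Fin 3 → ℝ) (i j : Fin 𝒯.n) (x : Space) :
    Fin 3 → ℝ :=
  let Mn : ℝ := ((1 / 2 : ℝ) • (evV (M i) x + evV (M j) x)) ⬝ᵥ 𝒯.normal i j
  (1 / 2 : ℝ) • (a i + a j) + (1 / 2 * (Mn / |Mn|)) • (a i - a j)

/-- The density flux `∑_e ∫_e (ρ v)^* · ⟦φ⟧ ds`, where `⟦φ⟧ = φ_i n_i + φ_j n_j` with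
`n_j = - n_i`. -/
def densityFlux (M : VectorField 𝒯) (ρ : ScalarField 𝒯) (v : VectorField 𝒯)
    (φ : ScalarField 𝒯) : ℝ :=
  𝒯.faceSum fun i j x =>
    𝒯.upwind M (fun K => ev (ρ K) x • evV (v K) x) i j x ⬝ᵥ
      (ev (φ i) x • 𝒯.normal i j + ev (φ j) x • (- 𝒯.normal i j))

/-- The momentum flux `∑_e ∫_e (n × M)^* · ⟦μ × w⟧ ds`, where `⟦g⟧ = g_i - g_j`. -/
def momentumFlux (M μ w : VectorField 𝒯) : ℝ :=
  𝒯.faceSum fun i j x =>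
    𝒯.upwind M (fun K => 𝒯.normal i j ⨯₃ evV (M K) x) i j x ⬝ᵥ
      (evV (μ i) x ⨯₃ evV (w i) x - evV (μ j) x ⨯₃ evV (w j) x)

end Mesh

/-! ### The semi-discrete scheme -/

/-- The Lorentz factor `γ(u) = √(1 + u · u / (m² c²))`. -/
def gam (m c : ℝ) (u : Fin 3 → ℝ) : ℝ := Real.sqrt (1 + u ⬝ᵥ u / (m ^ 2 * c ^ 2))

/-- `γ(m M / ρ)` -/
def fluidGam (m c r : ℝ) (M : Fin 3 → ℝ) : ℝ := gam m c ((m / r) • M)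

/-- `M / (ρ γ(m M / ρ))` -/
def velocity (m c r : ℝ) (M : Fin 3 → ℝ) : Fin 3 → ℝ := (1 / (r * fluidGam m c r M)) • M

/-- `γ(m M / ρ) - 1 - M² / (c² ρ² γ(m M / ρ))` -/
def potential (m c r : ℝ) (M : Fin 3 → ℝ) : ℝ :=
  fluidGam m c r M - 1 - M ⬝ᵥ M / (c ^ 2 * r ^ 2 * fluidGam m c r M)

/-- The time-dependent unknowns, together with the two projected quantities. -/
structure Trajectory (𝒯 : Mesh) (N : ℕ) where
  /-- fluid density `ρ_h` -/
  ρ : ℝ → ScalarField 𝒯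
  /-- fluid momentum `M_h` -/
  M : ℝ → VectorField 𝒯
  /-- electric field `E_h` -/
  E : ℝ → VectorField 𝒯
  /-- magnetic field `B_h` -/
  B : ℝ → VectorField 𝒯
  /-- projected velocity `w_h` -/
  w : ℝ → VectorField 𝒯
  /-- projection of `γ - 1 - M_h² / (c² ρ_h² γ)` -/
  P : ℝ → ScalarField 𝒯
  /-- particle positions `X_p` -/
  X : Fin N → ℝ → Space
  /-- particle momenta `U_p` -/
  U : Fin N → ℝ → Fin 3 → ℝ
  /-- a cell containing the particle `p`; piecewise polynomial functions are evaluated at `X_p`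
  through their restriction to this cell -/
  loc : Fin N → ℝ → Fin 𝒯.n

namespace Trajectory

variable {𝒯 : Mesh} {N : ℕ} (S : Trajectory 𝒯 N)

/-- Value of a vector field at the position of the particle `p` at time `t`. -/
def atParticle (f : VectorField 𝒯) (p : Fin N) (t : ℝ) : Fin 3 → ℝ := evV (f (S.loc p t)) (S.X p t)

/-- Value of a scalar field at the position of the particle `p` at time `t`; this is
`∫ δ(x - X_p) f dx`. -/
def atParticleS (f : ScalarField 𝒯) (p : Fin N) (t : ℝ) : ℝ := ev (f (S.loc p t)) (S.X p t)

/-- The pointwise time derivative of a time-dependent scalar field. -/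
def dt (f : ℝ → ScalarField 𝒯) (t : ℝ) (K : Fin 𝒯.n) (x : Space) : ℝ :=
  deriv (fun s => ev (f s K) x) t

/-- The pointwise time derivative of a time-dependent vector field. -/
def dtV (f : ℝ → VectorField 𝒯) (t : ℝ) (K : Fin 𝒯.n) (x : Space) : Fin 3 → ℝ :=
  fun i => deriv (fun s => ev (f s K i) x) t

/-- The density equation at time `t`. -/
def DensityEq (k : ℕ) (t : ℝ) : Prop :=
  ∀ φ ∈ 𝒯.DG (k + 1),
    𝒯.integral (fun K x => dt S.ρ t K x * ev (φ K) x) =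
      𝒯.integral (fun K x => ev (S.ρ t K) x * (evV (S.w t K) x ⬝ᵥ evV (grad (φ K)) x))
      - 𝒯.densityFlux (S.M t) (S.ρ t) (S.w t) φ

/-- The momentum equation at time `t`. -/
def MomentumEq (k : ℕ) (m c e : ℝ) (t : ℝ) : Prop :=
  ∀ μ ∈ 𝒯.RT k,
    𝒯.integral (fun K x => dtV S.M t K x ⬝ᵥ evV (μ K) x) =
      𝒯.integral (fun K x =>
        (evV (advect (S.w t K) (μ K)) x - evV (advect (μ K) (S.w t K)) x) ⬝ᵥ evV (S.M t K) x)
      - 𝒯.integral (fun K x =>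
        ev (S.ρ t K) x * (evV (μ K) x ⬝ᵥ evV (grad (S.P t K)) x)) * c ^ 2
      + e / m * 𝒯.integral (fun K x =>
        ev (S.ρ t K) x *
          ((evV (S.E t K) x + evV (S.w t K) x ⨯₃ ((1 / c) • evV (S.B t K) x)) ⬝ᵥ evV (μ K) x))
      + 𝒯.momentumFlux (S.M t) μ (S.w t)
      + 𝒯.densityFlux (S.M t) (S.ρ t) μ (S.P t) * c ^ 2

/-- Ampère's equation at time `t`; `wt p` is the weight of the particle `p`. -/
def AmpereEq (k : ℕ) (m c e : ℝ) (wt : Fin N → ℝ) (t : ℝ) : Prop :=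
  ∀ ν ∈ 𝒯.NedZero k,
    𝒯.integral (fun K x => dtV S.E t K x ⬝ᵥ evV (ν K) x) =
      c * 𝒯.integral (fun K x => evV (S.B t K) x ⬝ᵥ evV (curl (ν K)) x)
      - 4 * Real.pi * e / m *
        𝒯.integral (fun K x => ev (S.ρ t K) x * (evV (S.w t K) x ⬝ᵥ evV (ν K) x))
      - 4 * Real.pi * e / m *
        ∑ p, (wt p / gam m c (S.U p t)) * (S.U p t ⬝ᵥ S.atParticle ν p t)

/-- Faraday's equation at time `t`. -/
def FaradayEq (k : ℕ) (c : ℝ) (t : ℝ) : Prop :=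
  ∀ τ ∈ 𝒯.RTZero k,
    𝒯.integral (fun K x => dtV S.B t K x ⬝ᵥ evV (τ K) x) =
      - c * 𝒯.integral (fun K x => evV (τ K) x ⬝ᵥ evV (curl (S.E t K)) x)

/-- The equations of motion of the particles at time `t`. -/
def ParticleEq (m c e : ℝ) (t : ℝ) : Prop :=
  ∀ p,
    (∀ i, deriv (fun s => S.X p s i) t = S.U p t i / (m * gam m c (S.U p t))) ∧
    ∀ i, deriv (fun s => S.U p s i) t =
      e * (S.atParticle (S.E t) p t +
        (1 / (c * m * gam m c (S.U p t))) • (S.U p t ⨯₃ S.atParticle (S.B t) p t)) i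

/-- `S` solves the semi-discrete scheme with fluxes on `[0, T]`: all degrees of freedom are
absolutely continuous in time and the equations hold for almost every time (piecewise polynomial
fields jump along the path of a particle that crosses a face, so that the equations cannot be
required at every time). -/
structure IsSolution (k : ℕ) (m c e : ℝ) (wt : Fin N → ℝ) (T : ℝ) : Prop where
  ac_ρ : ∀ K a, AbsolutelyContinuousOnInterval (fun t => (S.ρ t K).coeff a) 0 T
  ac_M : ∀ K i a, AbsolutelyContinuousOnInterval (fun t => (S.M t K i).coeff a) 0 T
  ac_E : ∀ K i a, AbsolutelyContinuousOnInterval (fun t => (S.E t K i).coeff a) 0 T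
  ac_B : ∀ K i a, AbsolutelyContinuousOnInterval (fun t => (S.B t K i).coeff a) 0 T
  ac_X : ∀ p i, AbsolutelyContinuousOnInterval (fun t => S.X p t i) 0 T
  ac_U : ∀ p i, AbsolutelyContinuousOnInterval (fun t => S.U p t i) 0 T
  mem_ρ : ∀ t ∈ Icc 0 T, S.ρ t ∈ 𝒯.DG (k + 1)
  mem_M : ∀ t ∈ Icc 0 T, S.M t ∈ 𝒯.RT k
  mem_E : ∀ t ∈ Icc 0 T, S.E t ∈ 𝒯.NedZero k
  mem_B : ∀ t ∈ Icc 0 T, S.B t ∈ 𝒯.RTZero k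
  mem_X : ∀ t ∈ Icc 0 T, ∀ p, S.X p t ∈ 𝒯.cell (S.loc p t)
  /-- the density does not vanish, so that the quotients by `ρ_h` are defined -/
  ρ_ne_zero : ∀ t ∈ Icc 0 T, ∀ K, ∀ x ∈ 𝒯.cell K, ev (S.ρ t K) x ≠ 0
  proj_w : ∀ t ∈ Icc 0 T,
    𝒯.IsProjRT k (fun K x => velocity m c (ev (S.ρ t K) x) (evV (S.M t K) x)) (S.w t)
  proj_P : ∀ t ∈ Icc 0 T,
    𝒯.IsProjDG (k + 1) (fun K x => potential m c (ev (S.ρ t K) x) (evV (S.M t K) x)) (S.P t)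
  density : ∀ᵐ t ∂volume.restrict (Icc 0 T), S.DensityEq k t
  momentum : ∀ᵐ t ∂volume.restrict (Icc 0 T), S.MomentumEq k m c e t
  ampere : ∀ᵐ t ∂volume.restrict (Icc 0 T), S.AmpereEq k m c e wt t
  faraday : ∀ᵐ t ∂volume.restrict (Icc 0 T), S.FaradayEq k c t
  particle : ∀ᵐ t ∂volume.restrict (Icc 0 T), S.ParticleEq m c e t

/-! ### The invariants -/

/-- Total fluid mass. -/
def fluidMass (t : ℝ) : ℝ := 𝒯.integral fun K x => ev (S.ρ t K) x

/-- Total weight of the particles in `Ω_h`. -/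
def particleMass (wt : Fin N → ℝ) (t : ℝ) : ℝ :=
  ∑ p, indicator 𝒯.domain (fun _ => wt p) (S.X p t)

/-- Total energy. -/
def energy (m c : ℝ) (wt : Fin N → ℝ) (t : ℝ) : ℝ :=
  𝒯.integral (fun K x =>
    ev (S.ρ t K) x * (fluidGam m c (ev (S.ρ t K) x) (evV (S.M t K) x) - 1) * c ^ 2)
  + ∑ p, wt p * (gam m c (S.U p t) - 1) * m * c ^ 2
  + 1 / (8 * Real.pi) * 𝒯.integral (fun K x =>
    evV (S.E t K) x ⬝ᵥ evV (S.E t K) x + evV (S.B t K) x ⬝ᵥ evV (S.B t K) x)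

/-- The weak Gauss functional
`∫ [D - 4 π e (ρ_h / m + ∑ w_p δ(x - X_p))] φ dx`, where `D` is `∇_w · E_h` at time `t`. -/
def gauss (m e : ℝ) (wt : Fin N → ℝ) (D φ : ScalarField 𝒯) (t : ℝ) : ℝ :=
  𝒯.integral (fun K x => ev (D K) x * ev (φ K) x)
  - 4 * Real.pi * e *
    (𝒯.integral (fun K x => ev (S.ρ t K) x / m * ev (φ K) x) + ∑ p, wt p * S.atParticleS φ p t)

end Trajectory

end HybridFluid

end

/-! Every conserved quantity except the particle mass, which is read off from `mem_X`, is an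
absolutely continuous function of time, so it is enough that its derivative vanishes almost
everywhere (`ac_eq_of_ae_hasDerivAt_zero`). Fields of bounded degree are curves in a
finite-dimensional space (`ACCurve`), and their time derivatives stay in the finite element spaces
(`ACCurve.deriv_mem`).

Energy: the derivative of `ρ (γ - 1)` is `∂ₜρ` times `potential` plus `∂ₜM · velocity / c²`. As
`∂ₜρ` and `∂ₜM` lie in the discrete spaces, the two factors may be replaced by their projections `P`
and `w`. The equations are then tested with `P`, `w`, `E` and `B`: the transport terms and the first
flux vanish because both arguments equal `w`, the pressure terms and remaining fluxes cancel,
magnetic forces do no work, and the work of `E` on fluid and particles is balanced by Ampère's and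
Faraday's equations.

Gauss law: for `φ` in `QZero`, `∇φ` is an admissible test field in Ampère's equation
(`grad_mem_NedZero`), where the term with `B` drops out since `curl grad = 0`. The density equation
with test function `φ` has no flux because `φ` is single-valued on faces. Its values along a
particle path form an absolutely continuous function (`MemH1Zero.exists_lipschitz`) whose derivative
is almost everywhere that of the branch in use (`ae_deriv_eq_of_branches`), so charge and current
cancel.

Magnetic divergence: `curl E` lies in the test space of Faraday's equation (`curl_mem_RTZero`),
which therefore holds strongly as `∂ₜB = -c curl E` (`curveB_deriv_eq`). -/

noncomputable section

namespace HybridFluid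

open Filter Topology

/-! ### Absolutely continuous functions -/

section AbsolutelyContinuous

variable {a b : ℝ}

theorem ac_congr {f g : ℝ → ℝ} (hf : AbsolutelyContinuousOnInterval f a b)
    (h : EqOn f g (uIcc a b)) : AbsolutelyContinuousOnInterval g a b := by
  rw [absolutelyContinuousOnInterval_iff] at hf ⊢
  intro ε hε
  obtain ⟨δ, hδ, H⟩ := hf ε hε
  refine ⟨δ, hδ, fun E hE hlt => ?_⟩
  convert H E hE hlt using 2 with i hi
  rw [h (hE.1 i hi).1, h (hE.1 i hi).2]

theorem ac_const (r : ℝ) : AbsolutelyContinuousOnInterval (fun _ : ℝ => r) a b := by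
  rw [absolutelyContinuousOnInterval_iff]
  exact fun ε hε => ⟨1, one_pos, fun E _ _ => by simpa using hε⟩

theorem ac_sum {ι : Type*} (s : Finset ι) {f : ι → ℝ → ℝ}
    (hf : ∀ i ∈ s, AbsolutelyContinuousOnInterval (f i) a b) :
    AbsolutelyContinuousOnInterval (fun t => ∑ i ∈ s, f i t) a b := by
  classical
  induction s using Finset.induction_on with
  | empty => simpa using ac_const (a := a) (b := b) 0
  | insert i s hi ih =>
    simp only [Finset.sum_insert hi]
    exact (hf i (Finset.mem_insert_self i s)).fun_add
      (ih fun j hj => hf j (Finset.mem_insert_of_mem hj))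

/-- A function whose increments are dominated by those of finitely many absolutely continuous
functions is absolutely continuous. -/
theorem ac_of_dist_le {ι : Type*} [Fintype ι] {F : ℝ → ℝ} {f : ι → ℝ → ℝ} (C : ℝ)
    (hf : ∀ i, AbsolutelyContinuousOnInterval (f i) a b)
    (h : ∀ s ∈ uIcc a b, ∀ t ∈ uIcc a b, |F s - F t| ≤ C * ∑ i, |f i s - f i t|) :
    AbsolutelyContinuousOnInterval F a b := by
  have hlim : Tendsto (fun E : ℕ × (ℕ → ℝ × ℝ) =>
      C * ∑ j, ∑ i ∈ Finset.range E.1, dist (f j (E.2 i).1) (f j (E.2 i).2))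
      (AbsolutelyContinuousOnInterval.totalLengthFilter ⊓
        𝓟 (AbsolutelyContinuousOnInterval.disjWithin a b)) (𝓝 0) := by
    have := (tendsto_finsetSum Finset.univ fun j _ => hf j).const_mul C
    simpa using this
  refine squeeze_zero' (Eventually.of_forall fun E =>
    Finset.sum_nonneg fun i _ => dist_nonneg) ?_ hlim
  have hmem : ∀ᶠ E : ℕ × (ℕ → ℝ × ℝ) in AbsolutelyContinuousOnInterval.totalLengthFilter ⊓
      𝓟 (AbsolutelyContinuousOnInterval.disjWithin a b),
      E ∈ AbsolutelyContinuousOnInterval.disjWithin a b :=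
    mem_inf_of_right (mem_principal_self _)
  filter_upwards [hmem] with E hE
  rw [Finset.sum_comm, Finset.mul_sum]
  exact Finset.sum_le_sum fun i hi => h _ (hE.1 i hi).1 _ (hE.1 i hi).2

/-- Absolute continuity cannot be dropped: the Cantor function also has zero derivative almost
everywhere. -/
theorem ac_eq_of_ae_hasDerivAt_zero {F : ℝ → ℝ} {T : ℝ} (hT : 0 ≤ T)
    (hF : AbsolutelyContinuousOnInterval F 0 T)
    (h : ∀ᵐ t, t ∈ Icc 0 T → HasDerivAt F 0 t) {t : ℝ} (ht : t ∈ Icc 0 T) : F t = F 0 := by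
  rw [← uIcc_of_le hT] at h ht
  obtain ⟨C, hC⟩ := hF.const_of_ae_hasDerivAt_zero h
  rw [hC t ht, hC 0 left_mem_uIcc]

end AbsolutelyContinuous

/-- A function with values in a real vector space which on `[0, T]` is a finite linear combination
of fixed vectors with absolutely continuous coefficients. -/
structure ACCurve {V : Type*} [AddCommGroup V] [Module ℝ V] (f : ℝ → V) (T : ℝ) where
  /-- index type of the expansion -/
  ι : Type
  /-- finiteness of the expansion -/
  fin : Fintype ι
  /-- coefficients -/
  coef : ι → ℝ → ℝ
  /-- the fixed vectors -/
  vec : ι → V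
  ac : ∀ i, AbsolutelyContinuousOnInterval (coef i) 0 T
  eq : ∀ t ∈ Icc 0 T, f t = ∑ i, coef i t • vec i

/-! ### Calculus of linear and bilinear functionals along such curves. -/

namespace ACCurve

attribute [instance] ACCurve.fin

variable {V V' : Type*} [AddCommGroup V] [Module ℝ V] [AddCommGroup V'] [Module ℝ V'] {f : ℝ → V}
  {g : ℝ → V'} {T : ℝ}

/-- The time derivative of the curve. -/
def deriv (c : ACCurve f T) (t : ℝ) : V := ∑ i, _root_.deriv (c.coef i) t • c.vec i

/-- Interior times at which all coefficients are differentiable. -/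
def Good (c : ACCurve f T) (t : ℝ) : Prop :=
  t ∈ Ioo 0 T ∧ ∀ i, DifferentiableAt ℝ (c.coef i) t

theorem ae_good (c : ACCurve f T) (hT : 0 ≤ T) : ∀ᵐ t, t ∈ Icc 0 T → c.Good t := by
  have h1 : ∀ᵐ t : ℝ, ∀ i, t ∈ uIcc 0 T → DifferentiableAt ℝ (c.coef i) t :=
    ae_all_iff.2 fun i => (c.ac i).ae_differentiableAt
  have h0 : ∀ᵐ t : ℝ, t ≠ 0 := by simp [ae_iff]
  have hT' : ∀ᵐ t : ℝ, t ≠ T := by simp [ae_iff]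
  filter_upwards [h1, h0, hT'] with t h1 h0 h2 ht
  rw [uIcc_of_le hT] at h1
  exact ⟨⟨lt_of_le_of_ne ht.1 (Ne.symm h0), lt_of_le_of_ne ht.2 h2⟩, fun i => h1 i ht⟩

theorem Good.mem_Icc {c : ACCurve f T} {t : ℝ} (h : c.Good t) : t ∈ Icc 0 T :=
  Ioo_subset_Icc_self h.1

/-- The reason for asking `t ∈ Ioo 0 T` in `Good`: the expansion of the curve is known only on `[0,
T]`, whereas a two-sided derivative needs it on a neighbourhood. -/
theorem Good.eventually {c : ACCurve f T} {t : ℝ} (h : c.Good t) : ∀ᶠ s in 𝓝 t, s ∈ Icc 0 T :=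
  Icc_mem_nhds h.1.1 h.1.2

theorem ac_linear (c : ACCurve f T) (hT : 0 ≤ T) (ℓ : V →ₗ[ℝ] ℝ) :
    AbsolutelyContinuousOnInterval (fun t => ℓ (f t)) 0 T := by
  refine ac_congr (f := fun t => ∑ i, ℓ (c.vec i) * c.coef i t)
    (ac_sum _ fun i _ => (c.ac i).const_mul _) fun t ht => ?_
  rw [uIcc_of_le hT] at ht
  simp [c.eq t ht, mul_comm]

theorem hasDerivAt_linear (c : ACCurve f T) {t : ℝ} (h : c.Good t) (ℓ : V →ₗ[ℝ] ℝ) :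
    HasDerivAt (fun s => ℓ (f s)) (ℓ (c.deriv t)) t := by
  have h1 : HasDerivAt (fun s => ∑ i, c.coef i s * ℓ (c.vec i))
      (∑ i, _root_.deriv (c.coef i) t * ℓ (c.vec i)) t :=
    HasDerivAt.fun_sum fun i _ => (h.2 i).hasDerivAt.mul_const _
  have h2 : (fun s => ℓ (f s)) =ᶠ[𝓝 t] fun s => ∑ i, c.coef i s * ℓ (c.vec i) := by
    filter_upwards [h.eventually] with s hs
    simp [c.eq s hs]
  simpa [ACCurve.deriv] using h1.congr_of_eventuallyEq h2

theorem ac_bilinear (c : ACCurve f T) (d : ACCurve g T) (hT : 0 ≤ T) (B : V →ₗ[ℝ] V' →ₗ[ℝ] ℝ) :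
    AbsolutelyContinuousOnInterval (fun t => B (f t) (g t)) 0 T := by
  refine ac_congr (f := fun t => ∑ i, c.coef i t * B (c.vec i) (g t))
    (ac_sum _ fun i _ => (c.ac i).fun_mul (d.ac_linear hT _)) fun t ht => ?_
  rw [uIcc_of_le hT] at ht
  simp [c.eq t ht]

theorem hasDerivAt_bilinear (c : ACCurve f T) (d : ACCurve g T) {t : ℝ} (h : c.Good t)
    (h' : d.Good t) (B : V →ₗ[ℝ] V' →ₗ[ℝ] ℝ) :
    HasDerivAt (fun s => B (f s) (g s)) (B (c.deriv t) (g t) + B (f t) (d.deriv t)) t := by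
  have h1 : HasDerivAt (fun s => ∑ i, c.coef i s * B (c.vec i) (g s))
      (∑ i, (_root_.deriv (c.coef i) t * B (c.vec i) (g t) +
        c.coef i t * B (c.vec i) (d.deriv t))) t :=
    HasDerivAt.fun_sum fun i _ => (h.2 i).hasDerivAt.mul (d.hasDerivAt_linear h' _)
  have h2 : (fun s => B (f s) (g s)) =ᶠ[𝓝 t] fun s => ∑ i, c.coef i s * B (c.vec i) (g s) := by
    filter_upwards [h.eventually] with s hs
    simp [c.eq s hs]
  refine (h1.congr_of_eventuallyEq h2).congr_deriv ?_
  have hc : c.deriv t = ∑ i, _root_.deriv (c.coef i) t • c.vec i := rfl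
  rw [c.eq t h.mem_Icc, hc]
  simp [Finset.sum_add_distrib]

/-- The derivative of a curve lies in every subspace that contains the curve. -/
theorem deriv_mem (c : ACCurve f T) {t : ℝ} (h : c.Good t) (W : Submodule ℝ V)
    (hW : ∀ s ∈ Icc 0 T, f s ∈ W) : c.deriv t ∈ W := by
  -- A vector outside `W` is detected by a linear functional that vanishes on `W`. Along the curve
  -- this functional is zero near `t`, hence so is its derivative, which is its value at `c.deriv
  -- t`. No topology on `V` is involved.
  by_contra hn
  obtain ⟨ℓ, hℓ, hker⟩ := Submodule.exists_le_ker_of_notMem hn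
  refine hℓ ((c.hasDerivAt_linear h ℓ).unique ?_)
  refine (hasDerivAt_const t (0 : ℝ)).congr_of_eventuallyEq ?_
  filter_upwards [h.eventually] with s hs
  exact hker (hW s hs)

end ACCurve

/-! ### Piecewise polynomials as curves -/

/-- Exponents all of whose entries are at most `D`. -/
def expBox (D : ℕ) : Finset (Fin 3 →₀ ℕ) :=
  Finset.Iic (Finsupp.equivFunOnFinite.symm fun _ => D)

/-- The sum runs over a box fixed by `D` and not over the support of `p`, which would change with
time along a curve of polynomials. -/
theorem sum_expBox (D : ℕ) {p : MvPolynomial (Fin 3) ℝ} (hp : p.totalDegree ≤ D) :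
    p = ∑ d : expBox D, p.coeff d • MvPolynomial.monomial (d : Fin 3 →₀ ℕ) (1 : ℝ) := by
  rw [Finset.sum_coe_sort (expBox D) fun d => p.coeff d • MvPolynomial.monomial d (1 : ℝ)]
  conv_lhs => rw [p.as_sum]
  refine Finset.sum_subset_zero_on_sdiff (fun d hd => ?_) (fun d hd => ?_) fun d _ => ?_
  · refine Finset.mem_Iic.2 fun i => ?_
    have h1 : (d.sum fun _ e => e) ≤ D := (MvPolynomial.le_totalDegree hd).trans hp
    rw [Finsupp.sum_fintype _ _ (by simp)] at h1
    exact (Finset.single_le_sum (f := fun i => d i) (by simp) (Finset.mem_univ i)).trans h1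
  · rw [MvPolynomial.notMem_support_iff.1 (Finset.mem_sdiff.1 hd).2, zero_smul]
  · rw [MvPolynomial.smul_monomial, smul_eq_mul, mul_one]

theorem scalarField_eq_sum {𝒯 : Mesh} (D : ℕ) {f : ScalarField 𝒯}
    (hf : ∀ K, (f K).totalDegree ≤ D) :
    f = ∑ s : Fin 𝒯.n × expBox D,
      (f s.1).coeff s.2 • (Pi.single s.1 (MvPolynomial.monomial (s.2 : Fin 3 →₀ ℕ) (1 : ℝ)) :
        ScalarField 𝒯) := by
  funext K
  rw [Finset.sum_apply, Fintype.sum_prod_type, Finset.sum_eq_single K]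
  · simpa using sum_expBox D (hf K)
  · intro L _ hL
    simp [Pi.single_eq_of_ne hL.symm]
  · simp

theorem vectorField_eq_sum {𝒯 : Mesh} (D : ℕ) {f : VectorField 𝒯}
    (hf : ∀ K i, (f K i).totalDegree ≤ D) :
    f = ∑ s : Fin 𝒯.n × Fin 3 × expBox D,
      (f s.1 s.2.1).coeff s.2.2 • (Pi.single s.1 (Pi.single s.2.1
        (MvPolynomial.monomial (s.2.2 : Fin 3 →₀ ℕ) (1 : ℝ))) : VectorField 𝒯) := by
  funext K i
  rw [Finset.sum_apply, Finset.sum_apply, Fintype.sum_prod_type, Finset.sum_eq_single K]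
  · rw [Fintype.sum_prod_type, Finset.sum_eq_single i]
    · simpa using sum_expBox D (hf K i)
    · intro j _ hj
      simp [Pi.single_eq_of_ne hj.symm]
    · simp
  · intro L _ hL
    simp [Pi.single_eq_of_ne hL.symm]
  · simp

/-- A time-dependent scalar field of bounded degree with absolutely continuous coefficients. -/
def scalarCurve {𝒯 : Mesh} {f : ℝ → ScalarField 𝒯} {T : ℝ} (D : ℕ)
    (hac : ∀ K a, AbsolutelyContinuousOnInterval (fun t => (f t K).coeff a) 0 T)
    (hf : ∀ t ∈ Icc 0 T, ∀ K, (f t K).totalDegree ≤ D) : ACCurve f T where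
  ι := Fin 𝒯.n × expBox D
  fin := inferInstance
  coef s t := (f t s.1).coeff s.2
  vec s := Pi.single s.1 (MvPolynomial.monomial (s.2 : Fin 3 →₀ ℕ) (1 : ℝ))
  ac _ := hac _ _
  eq t ht := scalarField_eq_sum D (hf t ht)

/-- A time-dependent vector field of bounded degree with absolutely continuous coefficients. -/
def vectorCurve {𝒯 : Mesh} {f : ℝ → VectorField 𝒯} {T : ℝ} (D : ℕ)
    (hac : ∀ K i a, AbsolutelyContinuousOnInterval (fun t => (f t K i).coeff a) 0 T)
    (hf : ∀ t ∈ Icc 0 T, ∀ K i, (f t K i).totalDegree ≤ D) : ACCurve f T where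
  ι := Fin 𝒯.n × Fin 3 × expBox D
  fin := inferInstance
  coef s t := (f t s.1 s.2.1).coeff s.2.2
  vec s := Pi.single s.1 (Pi.single s.2.1 (MvPolynomial.monomial (s.2.2 : Fin 3 →₀ ℕ) (1 : ℝ)))
  ac _ := hac _ _ _
  eq t ht := vectorField_eq_sum D (hf t ht)

/-! ### Evaluation of polynomials -/

section Evaluation

variable (p q : MvPolynomial (Fin 3) ℝ) (u v : Fin 3 → MvPolynomial (Fin 3) ℝ) (x : Space)

@[simp] theorem ev_add : ev (p + q) x = ev p x + ev q x := by simp [ev]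
@[simp] theorem ev_sub : ev (p - q) x = ev p x - ev q x := by simp [ev]
@[simp] theorem ev_smul (a : ℝ) : ev (a • p) x = a * ev p x := by
  simp [ev, MvPolynomial.smul_eq_C_mul]
@[simp] theorem ev_zero : ev 0 x = 0 := by simp [ev]
@[simp] theorem ev_one : ev 1 x = 1 := by simp [ev]

@[simp] theorem evV_add : evV (u + v) x = evV u x + evV v x := by ext; simp [evV]
@[simp] theorem evV_smul (a : ℝ) : evV (a • u) x = a • evV u x := by ext; simp [evV]
@[simp] theorem evV_zero : evV 0 x = 0 := by ext; simp [evV]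

theorem continuous_ev : Continuous (ev p) := by
  unfold ev
  exact (MvPolynomial.continuous_eval p).comp (by fun_prop)

theorem continuous_evV : Continuous (evV u) := continuous_pi fun i => continuous_ev (u i)

theorem hasFDerivAt_ev :
    HasFDerivAt (ev p) (∑ i, ev (MvPolynomial.pderiv i p) x •
      (EuclideanSpace.proj i : Space →L[ℝ] ℝ)) x := by
  induction p using MvPolynomial.induction_on with
  | C a =>
    have : ev (MvPolynomial.C a) = fun _ => a := by ext y; simp [ev]
    rw [this]
    simpa using hasFDerivAt_const a x
  | add p q hp hq =>
    have : ev (p + q) = ev p + ev q := by ext y; simp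
    rw [this]
    refine (hp.add hq).congr_fderiv ?_
    simp [add_smul, Finset.sum_add_distrib]
  | mul_X p j hp =>
    have h1 : ev (p * MvPolynomial.X j) = fun y => ev p y * y j := by ext y; simp [ev]
    rw [h1]
    have h2 : HasFDerivAt (fun y : Space => y j) (EuclideanSpace.proj j : Space →L[ℝ] ℝ) x :=
      (EuclideanSpace.proj j : Space →L[ℝ] ℝ).hasFDerivAt
    refine (hp.mul h2).congr_fderiv ?_
    have h3 : ∀ i, ev (MvPolynomial.pderiv i (p * MvPolynomial.X j)) x =
        ev p x * (if j = i then 1 else 0) + x j * ev (MvPolynomial.pderiv i p) x := fun i => by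
      rw [Derivation.leibniz, MvPolynomial.pderiv_X]
      rcases eq_or_ne j i with rfl | hji
      · simp [ev]
      · simp [ev, hji]
    simp only [h3, add_smul, Finset.sum_add_distrib, mul_smul, ite_smul, one_smul, zero_smul,
      ← Finset.smul_sum, Finset.sum_ite_eq, Finset.mem_univ, if_true]

theorem partialD_ev (i : Fin 3) : partialD i (ev p) x = ev (MvPolynomial.pderiv i p) x := by
  rw [partialD, (hasFDerivAt_ev p x).fderiv]
  simp

/-- A polynomial that vanishes on a nonempty open set is zero. -/
theorem eq_zero_of_ev_eq_zero {U : Set Space} (hU : IsOpen U) (hne : U.Nonempty)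
    (h : ∀ y ∈ U, ev p y = 0) : p = 0 := by
  obtain ⟨y, hy⟩ := hne
  -- Passing to the sup norm turns balls into products of intervals; a polynomial vanishing on a
  -- product of infinite sets is zero.
  have hO : IsOpen ((WithLp.toLp 2 : (Fin 3 → ℝ) → Space) ⁻¹' U) :=
    hU.preimage (PiLp.continuous_toLp 2 _)
  obtain ⟨ε, hε, hb⟩ := Metric.isOpen_iff.1 hO (WithLp.ofLp y) (by simpa using hy)
  refine MvPolynomial.funext_set (fun i => Metric.ball (y i) ε) (fun i => ?_) fun z hz => ?_
  · rw [Real.ball_eq_Ioo]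
    exact Ioo_infinite (by linarith)
  · rw [map_zero]
    refine h (WithLp.toLp 2 z) (hb ?_)
    rw [ball_pi _ hε]
    exact hz

end Evaluation

/-! ### Integrals over the cells -/

namespace Mesh

variable (𝒯 : Mesh)

theorem isCompact_cell (K : Fin 𝒯.n) : IsCompact (𝒯.cell K) := by
  obtain ⟨s, hs⟩ := 𝒯.polytope K
  rw [hs]
  exact s.finite_toSet.isCompact_convexHull ℝ

theorem convex_cell (K : Fin 𝒯.n) : Convex ℝ (𝒯.cell K) := by
  obtain ⟨s, hs⟩ := 𝒯.polytope K
  rw [hs]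
  exact convex_convexHull ℝ _

theorem measurableSet_cell (K : Fin 𝒯.n) : MeasurableSet (𝒯.cell K) :=
  (𝒯.isCompact_cell K).measurableSet

theorem cell_subset_closure_interior (K : Fin 𝒯.n) : 𝒯.cell K ⊆ closure (interior (𝒯.cell K)) := by
  rw [(𝒯.convex_cell K).closure_interior_eq_closure_of_nonempty_interior (𝒯.interior_nonempty K)]
  exact subset_closure

theorem isCompact_domain : IsCompact 𝒯.domain := isCompact_iUnion fun K => 𝒯.isCompact_cell K

theorem measurableSet_domain : MeasurableSet 𝒯.domain := 𝒯.isCompact_domain.measurableSet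

instance (K : Fin 𝒯.n) : IsFiniteMeasure ((volume : Measure Space).restrict (𝒯.cell K)) :=
  ⟨by simpa using (𝒯.isCompact_cell K).measure_lt_top⟩

instance : IsFiniteMeasure ((volume : Measure Space).restrict 𝒯.domain) :=
  ⟨by simpa using 𝒯.isCompact_domain.measure_lt_top⟩

variable {𝒯}

theorem disjoint_interior_cell {K L : Fin 𝒯.n} (h : K ≠ L) :
    Disjoint (interior (𝒯.cell K)) (𝒯.cell L) :=
  ((𝒯.disjoint_interior K L h).closure_right isOpen_interior).mono_right
    (𝒯.cell_subset_closure_interior L)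

/-- A common point of two cells is not interior to the first, so it lies on the frontier of a convex
set, which is null. -/
theorem aedisjoint_cell {K L : Fin 𝒯.n} (h : K ≠ L) :
    AEDisjoint (volume : Measure Space) (𝒯.cell K) (𝒯.cell L) := by
  refine measure_mono_null (fun x hx => ?_) ((𝒯.convex_cell K).addHaar_frontier volume)
  exact ⟨subset_closure hx.1, fun hi => (disjoint_interior_cell h).le_bot ⟨hi, hx.2⟩⟩

theorem integrableOn_cell {K : Fin 𝒯.n} {F : Space → ℝ} (h : ContinuousOn F (𝒯.cell K)) :
    IntegrableOn F (𝒯.cell K) :=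
  h.integrableOn_compact (𝒯.isCompact_cell K)

theorem setIntegral_domain {F : Space → ℝ} (h : IntegrableOn F 𝒯.domain) :
    ∫ x in 𝒯.domain, F x = ∑ K, ∫ x in 𝒯.cell K, F x := by
  rw [domain, integral_iUnion_ae (fun K => (𝒯.measurableSet_cell K).nullMeasurableSet)
    (fun K L hKL => aedisjoint_cell hKL) h, tsum_fintype]

section Integral

variable {F G : Fin 𝒯.n → Space → ℝ}

theorem integral_add (hF : ∀ K, ContinuousOn (F K) (𝒯.cell K))
    (hG : ∀ K, ContinuousOn (G K) (𝒯.cell K)) :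
    𝒯.integral (fun K x => F K x + G K x) = 𝒯.integral F + 𝒯.integral G := by
  simp only [integral, ← Finset.sum_add_distrib]
  exact Finset.sum_congr rfl fun K _ =>
    MeasureTheory.integral_add (integrableOn_cell (hF K)) (integrableOn_cell (hG K))

theorem integral_const_mul (a : ℝ) (F : Fin 𝒯.n → Space → ℝ) :
    𝒯.integral (fun K x => a * F K x) = a * 𝒯.integral F := by
  simp only [integral, MeasureTheory.integral_const_mul, Finset.mul_sum]

theorem integral_congr (h : ∀ K, ∀ x ∈ 𝒯.cell K, F K x = G K x) :
    𝒯.integral F = 𝒯.integral G :=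
  Finset.sum_congr rfl fun K _ => setIntegral_congr_fun (𝒯.measurableSet_cell K) fun x hx => h K x hx

theorem integral_finsetSum {ι : Type*} [Fintype ι] {F : ι → Fin 𝒯.n → Space → ℝ}
    (hF : ∀ i K, ContinuousOn (F i K) (𝒯.cell K)) :
    𝒯.integral (fun K x => ∑ i, F i K x) = ∑ i, 𝒯.integral (F i) := by
  simp only [integral]
  rw [Finset.sum_comm]
  exact Finset.sum_congr rfl fun K _ =>
    MeasureTheory.integral_finsetSum _ fun i _ => integrableOn_cell (hF i K)

theorem integral_zero : 𝒯.integral (fun _ _ => 0) = 0 := by simp [integral]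

/-- The functional `f ↦ ∫ f u`. -/
def pairS (u : Fin 𝒯.n → Space → ℝ) (hu : ∀ K, ContinuousOn (u K) (𝒯.cell K)) :
    ScalarField 𝒯 →ₗ[ℝ] ℝ where
  toFun f := 𝒯.integral fun K x => ev (f K) x * u K x
  map_add' f g := by
    refine Eq.trans ?_ (integral_add (fun K => (continuous_ev (f K)).continuousOn.mul (hu K))
      fun K => (continuous_ev (g K)).continuousOn.mul (hu K))
    simp [add_mul]
  map_smul' a f := by
    rw [RingHom.id_apply, smul_eq_mul, ← integral_const_mul]
    simp [mul_assoc]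

theorem continuousOn_dotProduct {u v : Space → Fin 3 → ℝ} {s : Set Space} (hu : ContinuousOn u s)
    (hv : ContinuousOn v s) : ContinuousOn (fun x => u x ⬝ᵥ v x) s := by
  simp only [dotProduct]
  exact continuousOn_finsetSum _ fun i _ =>
    (continuousOn_pi.1 hu i).mul (continuousOn_pi.1 hv i)

/-- The functional `f ↦ ∫ f · u`. -/
def pairV (u : Fin 𝒯.n → Space → Fin 3 → ℝ) (hu : ∀ K, ContinuousOn (u K) (𝒯.cell K)) :
    VectorField 𝒯 →ₗ[ℝ] ℝ where
  toFun f := 𝒯.integral fun K x => evV (f K) x ⬝ᵥ u K x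
  map_add' f g := by
    rw [← integral_add (fun K => continuousOn_dotProduct (continuous_evV _).continuousOn (hu K))
      fun K => continuousOn_dotProduct (continuous_evV _).continuousOn (hu K)]
    simp [add_dotProduct]
  map_smul' a f := by
    rw [RingHom.id_apply, smul_eq_mul, ← integral_const_mul]
    simp

/-- The `L²` inner product of scalar fields. -/
def innerS : ScalarField 𝒯 →ₗ[ℝ] ScalarField 𝒯 →ₗ[ℝ] ℝ :=
  LinearMap.mk₂ ℝ (fun f g => 𝒯.integral fun K x => ev (f K) x * ev (g K) x)
    (fun f f' g => (pairS (fun K => ev (g K)) fun K => (continuous_ev _).continuousOn).map_add f f')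
    (fun a f g => (pairS (fun K => ev (g K)) fun K => (continuous_ev _).continuousOn).map_smul a f)
    (fun f g g' => by
      simp only [mul_comm (ev (f _) _)]
      exact (pairS (fun K => ev (f K)) fun K => (continuous_ev _).continuousOn).map_add g g')
    (fun a f g => by
      simp only [mul_comm (ev (f _) _)]
      exact (pairS (fun K => ev (f K)) fun K => (continuous_ev _).continuousOn).map_smul a g)

/-- The `L²` inner product of vector fields. -/
def innerV : VectorField 𝒯 →ₗ[ℝ] VectorField 𝒯 →ₗ[ℝ] ℝ :=
  LinearMap.mk₂ ℝ (fun f g => 𝒯.integral fun K x => evV (f K) x ⬝ᵥ evV (g K) x)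
    (fun f f' g =>
      (pairV (fun K => evV (g K)) fun K => (continuous_evV _).continuousOn).map_add f f')
    (fun a f g =>
      (pairV (fun K => evV (g K)) fun K => (continuous_evV _).continuousOn).map_smul a f)
    (fun f g g' => by
      simp only [dotProduct_comm (evV (f _) _)]
      exact (pairV (fun K => evV (f K)) fun K => (continuous_evV _).continuousOn).map_add g g')
    (fun a f g => by
      simp only [dotProduct_comm (evV (f _) _)]
      exact (pairV (fun K => evV (f K)) fun K => (continuous_evV _).continuousOn).map_smul a g)

theorem innerS_apply (f g : ScalarField 𝒯) :
    innerS f g = 𝒯.integral fun K x => ev (f K) x * ev (g K) x := rfl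

theorem innerV_apply (f g : VectorField 𝒯) :
    innerV f g = 𝒯.integral fun K x => evV (f K) x ⬝ᵥ evV (g K) x := rfl

theorem innerV_comm (f g : VectorField 𝒯) : innerV f g = innerV g f := by
  simp only [innerV_apply, dotProduct_comm (evV (f _) _)]

/-- A nonnegative continuous function with vanishing integral over the cells vanishes in the
interior of each cell. -/
theorem eq_zero_of_integral_eq_zero (hc : ∀ K, Continuous (F K)) (h0 : ∀ K x, 0 ≤ F K x)
    (h : 𝒯.integral F = 0) (K : Fin 𝒯.n) : ∀ x ∈ interior (𝒯.cell K), F K x = 0 := by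
  have h1 := (Finset.sum_eq_zero_iff_of_nonneg fun L _ =>
    setIntegral_nonneg (𝒯.measurableSet_cell L) fun x _ => h0 L x).1 h K (Finset.mem_univ K)
  have h2 : F K =ᵐ[volume.restrict (𝒯.cell K)] 0 :=
    (integral_eq_zero_iff_of_nonneg (fun x => h0 K x)
      (integrableOn_cell (hc K).continuousOn)).1 h1
  exact Measure.eqOn_open_of_ae_eq (ae_restrict_of_ae_restrict_of_subset interior_subset h2)
    isOpen_interior (hc K).continuousOn continuousOn_const

/-- Fields are families of formal polynomials, so definiteness of the `L²` product rests on the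
cells having nonempty interior. -/
theorem eq_zero_of_innerS_self {f : ScalarField 𝒯} (h : innerS f f = 0) : f = 0 := by
  funext K
  refine eq_zero_of_ev_eq_zero _ isOpen_interior (𝒯.interior_nonempty K) fun x hx => ?_
  exact mul_self_eq_zero.1 (eq_zero_of_integral_eq_zero
    (fun K => (continuous_ev (f K)).mul (continuous_ev (f K))) (fun K x => mul_self_nonneg _) h K x hx)

theorem eq_zero_of_innerV_self {f : VectorField 𝒯} (h : innerV f f = 0) : f = 0 := by
  funext K i
  refine eq_zero_of_ev_eq_zero _ isOpen_interior (𝒯.interior_nonempty K) fun x hx => ?_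
  have h1 := eq_zero_of_integral_eq_zero (F := fun K x => evV (f K) x ⬝ᵥ evV (f K) x)
    (fun K => (continuous_evV (f K)).dotProduct (continuous_evV (f K)))
    (fun K x => Finset.sum_nonneg fun i _ => mul_self_nonneg _) h K x hx
  exact congrFun (dotProduct_self_eq_zero.1 h1) i

end Integral

end Mesh

/-! ### Test functions -/

theorem IsTest.continuous {ψ : Space → ℝ} (h : IsTest ψ) : Continuous ψ := h.1.continuous

theorem IsTest.differentiable {ψ : Space → ℝ} (h : IsTest ψ) : Differentiable ℝ ψ :=
  h.1.differentiable (by simp)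

theorem IsTest.partialD {ψ : Space → ℝ} (h : IsTest ψ) (i : Fin 3) : IsTest (partialD i ψ) :=
  ⟨(h.1.fderiv_right (m := ∞) (by simp)).clm_apply contDiff_const, h.2.fderiv_apply ℝ _⟩

theorem IsTest.sub {ψ χ : Space → ℝ} (h : IsTest ψ) (h' : IsTest χ) :
    IsTest (fun x => ψ x - χ x) := ⟨h.1.sub h'.1, h.2.sub h'.2⟩

theorem isTest_zero : IsTest (fun _ => 0) := ⟨contDiff_const, HasCompactSupport.zero⟩

theorem tsupport_partialD_subset (i : Fin 3) (ψ : Space → ℝ) :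
    tsupport (partialD i ψ) ⊆ tsupport ψ :=
  tsupport_fderiv_apply_subset ℝ _

theorem partialD_comm {ψ : Space → ℝ} (h : IsTest ψ) (i j : Fin 3) (x : Space) :
    partialD i (partialD j ψ) x = partialD j (partialD i ψ) x := by
  have hd : DifferentiableAt ℝ (fderiv ℝ ψ) x :=
    ((h.1.fderiv_right (m := ∞) (by simp)).differentiable (by simp)) x
  have key : ∀ a b : Fin 3, partialD a (partialD b ψ) x =
      fderiv ℝ (fderiv ℝ ψ) x (EuclideanSpace.single a 1) (EuclideanSpace.single b 1) :=
    fun a b => by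
      have : partialD b ψ = fun y => fderiv ℝ ψ y (EuclideanSpace.single b 1) := rfl
      rw [this, HybridFluid.partialD, fderiv_clm_apply hd (differentiableAt_const _)]
      simp
  rw [key, key]
  exact (h.1.contDiffAt.isSymmSndFDerivAt (by
    simpa using WithTop.coe_le_coe.2 (le_top : (2 : ℕ∞) ≤ ⊤))) _ _

theorem partialD_sub {ψ χ : Space → ℝ} (h : IsTest ψ) (h' : IsTest χ) (i : Fin 3) (x : Space) :
    partialD i (fun y => ψ y - χ y) x = partialD i ψ x - partialD i χ x := by
  simp [partialD, fderiv_fun_sub (h.differentiable x) (h'.differentiable x)]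

theorem integral_ev_mul_partialD (p : MvPolynomial (Fin 3) ℝ) {ψ : Space → ℝ} (h : IsTest ψ)
    (i : Fin 3) :
    ∫ x, ev p x * partialD i ψ x = - ∫ x, ev (MvPolynomial.pderiv i p) x * ψ x := by
  have hp : ∀ x, fderiv ℝ (ev p) x (EuclideanSpace.single i 1) =
    ev (MvPolynomial.pderiv i p) x := fun x => partialD_ev p x i
  simp only [← hp]
  refine integral_mul_fderiv_eq_neg_fderiv_mul_of_integrable ?_ ?_ ?_
    (fun x _ => (hasFDerivAt_ev p x).differentiableAt) fun x _ => h.differentiable x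
  · simp only [hp]
    exact ((continuous_ev _).mul h.continuous).integrable_of_hasCompactSupport h.2.mul_left
  · exact ((continuous_ev p).mul (h.partialD i).continuous).integrable_of_hasCompactSupport
      (h.partialD i).2.mul_left
  · exact ((continuous_ev _).mul h.continuous).integrable_of_hasCompactSupport h.2.mul_left

namespace Mesh

variable {𝒯 : Mesh}

/-! ### Identification of weak derivatives with cellwise derivatives -/

theorem integral_eq_of_supported {F : Fin 𝒯.n → Space → ℝ} (K : Fin 𝒯.n)
    (h : ∀ L, ∀ x ∉ interior (𝒯.cell K), F L x = 0) : 𝒯.integral F = ∫ x, F K x := by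
  rw [integral, Finset.sum_eq_single K]
  · exact setIntegral_eq_integral_of_forall_compl_eq_zero fun x hx =>
      h K x fun hi => hx (interior_subset hi)
  · intro L _ hL
    exact setIntegral_eq_zero_of_forall_eq_zero fun x hx =>
      h L x fun hi => (disjoint_interior_cell hL.symm).le_bot ⟨hi, hx⟩
  · simp

theorem integrableOn_mul_test {g : Space → ℝ} (hg : MemLp g 2 (volume.restrict 𝒯.domain))
    {ψ : Space → ℝ} (hψ : IsTest ψ) : IntegrableOn (fun x => g x * ψ x) 𝒯.domain := by
  obtain ⟨C, hC⟩ := hψ.2.exists_bound_of_continuous hψ.continuous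
  exact (hg.integrable (by norm_num)).mul_bdd hψ.continuous.aestronglyMeasurable
    (ae_of_all _ hC)

/-- A function that agrees in the distributional sense on each open cell with a continuous function
can be replaced by it in integrals over the domain. -/
theorem setIntegral_eq_integral_of_forall_supported {g : Space → ℝ}
    (hg : MemLp g 2 (volume.restrict 𝒯.domain)) {h : Fin 𝒯.n → Space → ℝ}
    (hh : ∀ K, Continuous (h K))
    (H : ∀ K, ∀ ψ, IsTest ψ → tsupport ψ ⊆ interior (𝒯.cell K) →
      ∫ x in 𝒯.domain, g x * ψ x = ∫ x, h K x * ψ x)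
    {ψ : Space → ℝ} (hψ : IsTest ψ) :
    ∫ x in 𝒯.domain, g x * ψ x = 𝒯.integral fun K x => h K x * ψ x := by
  rw [setIntegral_domain (integrableOn_mul_test hg hψ)]
  refine Finset.sum_congr rfl fun K _ => ?_
  have hgi : IntegrableOn g 𝒯.domain := hg.integrable (by norm_num)
  have hsub : interior (𝒯.cell K) ⊆ 𝒯.domain :=
    interior_subset.trans (subset_iUnion _ K)
  -- Fundamental lemma of the calculus of variations on the open cell, where `H` supplies the
  -- vanishing integrals.
  have h1 : ∀ᵐ x, x ∈ interior (𝒯.cell K) → g x - h K x = 0 := by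
    refine isOpen_interior.ae_eq_zero_of_integral_contDiff_smul_eq_zero
      ((hgi.mono_set hsub).locallyIntegrableOn.sub
        ((hh K).continuousOn.locallyIntegrableOn isOpen_interior.measurableSet)) ?_
    intro ψ h1 h2 h3
    have h4 := H K ψ ⟨h1, h2⟩ h3
    have h5 : ∫ x in 𝒯.domain, g x * ψ x = ∫ x in interior (𝒯.cell K), g x * ψ x :=
      (setIntegral_eq_of_subset_of_forall_sdiff_eq_zero 𝒯.measurableSet_domain hsub fun x hx => by
        rw [image_eq_zero_of_notMem_tsupport fun hm => hx.2 (h3 hm), mul_zero])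
    have h6 : ∫ x, h K x * ψ x = ∫ x in interior (𝒯.cell K), h K x * ψ x :=
      (setIntegral_eq_integral_of_forall_compl_eq_zero fun x hx => by
        rw [image_eq_zero_of_notMem_tsupport fun hm => hx (h3 hm), mul_zero]).symm
    have h7 : ∫ x, ψ x • (g x - h K x) = ∫ x in interior (𝒯.cell K), ψ x • (g x - h K x) :=
      (setIntegral_eq_integral_of_forall_compl_eq_zero fun x hx => by
        rw [image_eq_zero_of_notMem_tsupport fun hm => hx (h3 hm), zero_smul]).symm
    have h8 : IntegrableOn (fun x => g x * ψ x) (interior (𝒯.cell K)) :=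
      (integrableOn_mul_test hg ⟨h1, h2⟩).mono_set hsub
    have h9 : IntegrableOn (fun x => h K x * ψ x) (interior (𝒯.cell K)) :=
      (integrableOn_cell ((hh K).mul h1.continuous).continuousOn).mono_set interior_subset
    rw [h7]
    calc ∫ x in interior (𝒯.cell K), ψ x • (g x - h K x)
        = ∫ x in interior (𝒯.cell K), (g x * ψ x - h K x * ψ x) := by
          congr 1; ext x; simp only [smul_eq_mul]; ring
      _ = 0 := by rw [MeasureTheory.integral_sub h8 h9, ← h5, ← h6, h4, sub_self]
  have h2 : ∀ᵐ x, x ∉ frontier (𝒯.cell K) :=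
    measure_eq_zero_iff_ae_notMem.1 ((𝒯.convex_cell K).addHaar_frontier volume)
  refine setIntegral_congr_ae (𝒯.measurableSet_cell K) ?_
  filter_upwards [h1, h2] with x h1 h2 hx
  have hxi : x ∈ interior (𝒯.cell K) := by
    by_contra hn
    exact h2 ⟨subset_closure hx, hn⟩
  rw [sub_eq_zero.1 (h1 hxi)]

/-- Green's formula without boundary term for `H¹` functions with zero boundary values. -/
theorem MemH1Zero.green {f : ScalarField 𝒯} (hf : 𝒯.MemH1Zero f) {ψ : Space → ℝ} (hψ : IsTest ψ)
    (i : Fin 3) :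
    𝒯.integral (fun K x => ev (f K) x * partialD i ψ x) =
      - 𝒯.integral (fun K x => ev (MvPolynomial.pderiv i (f K)) x * ψ x) := by
  obtain ⟨g, hg, H⟩ := hf
  rw [H ψ hψ i, setIntegral_eq_integral_of_forall_supported (hg i)
    (h := fun K => ev (MvPolynomial.pderiv i (f K))) (fun K => continuous_ev _) _ hψ]
  -- For `χ` supported in one open cell, classical integration by parts applies as well and
  -- identifies `g i` there. The absence of face terms for general `ψ` is already contained in the
  -- weak formula `H`.
  intro K χ hχ hs
  have h1 := H χ hχ i
  rw [integral_eq_of_supported K, integral_ev_mul_partialD _ hχ] at h1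
  · linarith
  · intro L x hx
    rw [image_eq_zero_of_notMem_tsupport fun hm => hx (hs (tsupport_partialD_subset i χ hm)),
      mul_zero]

theorem curlT_eq_zero {ψ : Fin 3 → Space → ℝ} {x : Space} (h : ∀ i, x ∉ tsupport (ψ i)) :
    curlT ψ x = 0 := by
  have key : ∀ i j, partialD i (ψ j) x = 0 := fun i j =>
    image_eq_zero_of_notMem_tsupport fun hm => h j (tsupport_partialD_subset i (ψ j) hm)
  ext i
  fin_cases i <;> simp [curlT, key]

theorem integral_sum_sub {a₁ b₁ a₂ b₂ a₃ b₃ : Space → ℝ} (ha₁ : Integrable a₁) (hb₁ : Integrable b₁)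
    (ha₂ : Integrable a₂) (hb₂ : Integrable b₂) (ha₃ : Integrable a₃) (hb₃ : Integrable b₃) :
    ∫ x, ((a₁ x - b₁ x) + (a₂ x - b₂ x)) + (a₃ x - b₃ x) =
      ((∫ x, a₁ x) - ∫ x, b₁ x) + ((∫ x, a₂ x) - ∫ x, b₂ x) + ((∫ x, a₃ x) - ∫ x, b₃ x) := by
  have h1 : Integrable fun x => a₁ x - b₁ x := ha₁.sub hb₁
  have h2 : Integrable fun x => a₂ x - b₂ x := ha₂.sub hb₂
  have h3 : Integrable fun x => a₃ x - b₃ x := ha₃.sub hb₃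
  have h12 : Integrable fun x => (a₁ x - b₁ x) + (a₂ x - b₂ x) := h1.add h2
  rw [MeasureTheory.integral_add h12 h3, MeasureTheory.integral_add h1 h2,
    MeasureTheory.integral_sub ha₁ hb₁, MeasureTheory.integral_sub ha₂ hb₂,
    MeasureTheory.integral_sub ha₃ hb₃]

theorem integral_evV_dotProduct_curlT (v : Fin 3 → MvPolynomial (Fin 3) ℝ) {ψ : Fin 3 → Space → ℝ}
    (h : ∀ i, IsTest (ψ i)) :
    ∫ x, evV v x ⬝ᵥ curlT ψ x = ∫ x, evV (curl v) x ⬝ᵥ (fun i => ψ i x) := by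
  have hi : ∀ p : MvPolynomial (Fin 3) ℝ, ∀ i j, Integrable fun x => ev p x * partialD i (ψ j) x :=
    fun p i j => ((continuous_ev p).mul ((h j).partialD i).continuous).integrable_of_hasCompactSupport
      ((h j).partialD i).2.mul_left
  have hj : ∀ p : MvPolynomial (Fin 3) ℝ, ∀ j, Integrable fun x => ev p x * ψ j x :=
    fun p j => ((continuous_ev p).mul (h j).continuous).integrable_of_hasCompactSupport
      (h j).2.mul_left
  have e1 : ∀ x, evV v x ⬝ᵥ curlT ψ x =
      ((ev (v 0) x * partialD 1 (ψ 2) x - ev (v 0) x * partialD 2 (ψ 1) x) +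
      (ev (v 1) x * partialD 2 (ψ 0) x - ev (v 1) x * partialD 0 (ψ 2) x)) +
      (ev (v 2) x * partialD 0 (ψ 1) x - ev (v 2) x * partialD 1 (ψ 0) x) := fun x => by
    simp [dotProduct, Fin.sum_univ_three, curlT, evV]; ring
  have e2 : ∀ x, evV (curl v) x ⬝ᵥ (fun i => ψ i x) =
      ((ev (MvPolynomial.pderiv 1 (v 2)) x * ψ 0 x - ev (MvPolynomial.pderiv 2 (v 1)) x * ψ 0 x) +
      (ev (MvPolynomial.pderiv 2 (v 0)) x * ψ 1 x - ev (MvPolynomial.pderiv 0 (v 2)) x * ψ 1 x)) +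
      (ev (MvPolynomial.pderiv 0 (v 1)) x * ψ 2 x - ev (MvPolynomial.pderiv 1 (v 0)) x * ψ 2 x) :=
    fun x => by
      simp [dotProduct, Fin.sum_univ_three, curl, evV]; ring
  simp only [e1, e2]
  refine (integral_sum_sub (hi _ _ _) (hi _ _ _) (hi _ _ _) (hi _ _ _) (hi _ _ _)
    (hi _ _ _)).trans (Eq.trans ?_ (integral_sum_sub (hj _ _) (hj _ _) (hj _ _) (hj _ _) (hj _ _)
    (hj _ _)).symm)
  simp only [integral_ev_mul_partialD _ (h _)]
  ring

/-- Green's formula without boundary term for `H(curl)` fields with vanishing tangential trace. -/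
theorem MemHcurlZero.green {f : VectorField 𝒯} (hf : 𝒯.MemHcurlZero f) {ψ : Fin 3 → Space → ℝ}
    (hψ : ∀ i, IsTest (ψ i)) :
    𝒯.integral (fun K x => evV (f K) x ⬝ᵥ curlT ψ x) =
      𝒯.integral (fun K x => evV (curl (f K)) x ⬝ᵥ (fun i => ψ i x)) := by
  obtain ⟨g, hg, H⟩ := hf
  rw [H ψ hψ, MeasureTheory.integral_finsetSum _ fun i _ => integrableOn_mul_test (hg i) (hψ i)]
  have key : ∀ i, ∫ x in 𝒯.domain, g i x * ψ i x =
      𝒯.integral fun K x => evV (curl (f K)) x i * ψ i x := fun i => by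
    refine setIntegral_eq_integral_of_forall_supported (hg i)
      (fun K => continuous_ev (curl (f K) i)) (fun K χ hχ hs => ?_) (hψ i)
    -- A vector test field with a single nonzero component isolates the `i`-th component of the weak
    -- curl.
    set η : Fin 3 → Space → ℝ := Pi.single i χ with hη
    have hηi : η i = χ := by simp [hη]
    have hηj : ∀ j, j ≠ i → η j = fun _ => 0 := fun j hj => by
      rw [hη, Pi.single_eq_of_ne hj]; rfl
    have hηT : ∀ j, IsTest (η j) := fun j => by
      rcases eq_or_ne j i with rfl | hj
      · rwa [hηi]
      · rw [hηj j hj]; exact isTest_zero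
    have hsupp : ∀ x, x ∉ interior (𝒯.cell K) → ∀ j, x ∉ tsupport (η j) := fun x hx j => by
      rcases eq_or_ne j i with rfl | hj
      · rw [hηi]; exact fun hm => hx (hs hm)
      · rw [hηj j hj, show (fun _ : Space => (0 : ℝ)) = 0 from rfl, tsupport_zero]; simp
    have h1 := H η hηT
    rw [integral_eq_of_supported K (fun L x hx => by rw [curlT_eq_zero (hsupp x hx)]; simp),
      integral_evV_dotProduct_curlT _ hηT] at h1
    have e1 : ∀ x, ∑ j, g j x * η j x = g i x * χ x := fun x => by
      rw [Finset.sum_eq_single i (fun j _ hj => by rw [hηj j hj, mul_zero]) (by simp), hηi]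
    have e2 : ∀ x, evV (curl (f K)) x ⬝ᵥ (fun j => η j x) = ev (curl (f K) i) x * χ x := fun x => by
      rw [dotProduct, Finset.sum_eq_single i (fun j _ hj => by rw [hηj j hj, mul_zero]) (by simp),
        hηi]
      rfl
    simp only [e1, e2] at h1
    exact h1.symm
  simp only [key, dotProduct]
  exact (integral_finsetSum fun i K =>
    ((continuous_ev (curl (f K) i)).mul (hψ i).continuous).continuousOn).symm

end Mesh

/-! ### Degrees -/

theorem totalDegree_pderiv_le {p : MvPolynomial (Fin 3) ℝ} {k : ℕ} (h : p.totalDegree ≤ k + 1)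
    (i : Fin 3) : (MvPolynomial.pderiv i p).totalDegree ≤ k := by
  rw [MvPolynomial.totalDegree]
  refine Finset.sup_le fun d hd => ?_
  have h1 : p.coeff (d + Finsupp.single i 1) ≠ 0 := fun h0 => by
    rw [MvPolynomial.mem_support_iff, MvPolynomial.coeff_pderiv, h0, zero_mul] at hd
    exact hd rfl
  have h2 := (MvPolynomial.le_totalDegree (MvPolynomial.mem_support_iff.2 h1)).trans h
  rw [Finsupp.sum_add_index' (by simp) (by simp), Finsupp.sum_single_index rfl] at h2
  omega

theorem totalDegree_add_le {p q : MvPolynomial (Fin 3) ℝ} {k : ℕ} (hp : p.totalDegree ≤ k)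
    (hq : q.totalDegree ≤ k) : (p + q).totalDegree ≤ k :=
  (MvPolynomial.totalDegree_add p q).trans (max_le hp hq)

theorem totalDegree_sub_le {p q : MvPolynomial (Fin 3) ℝ} {k : ℕ} (hp : p.totalDegree ≤ k)
    (hq : q.totalDegree ≤ k) : (p - q).totalDegree ≤ k :=
  (MvPolynomial.totalDegree_sub p q).trans (max_le hp hq)

theorem totalDegree_mul_X_le {p : MvPolynomial (Fin 3) ℝ} {k : ℕ} (hp : p.totalDegree ≤ k)
    (i : Fin 3) : (MvPolynomial.X i * p).totalDegree ≤ k + 1 :=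
  (MvPolynomial.totalDegree_mul _ _).trans (by rw [MvPolynomial.totalDegree_X]; omega)

theorem totalDegree_add_cross_le {k : ℕ} {p q : Fin 3 → MvPolynomial (Fin 3) ℝ}
    (hp : ∀ i, (p i).totalDegree ≤ k) (hq : ∀ i, (q i).totalDegree ≤ k) (i : Fin 3) :
    ((p + posField ⨯₃ q) i).totalDegree ≤ k + 1 := by
  refine totalDegree_add_le ((hp i).trans k.le_succ) ?_
  fin_cases i <;>
    exact totalDegree_sub_le (totalDegree_mul_X_le (hq _) _) (totalDegree_mul_X_le (hq _) _)

theorem totalDegree_curl_le {k : ℕ} {v : Fin 3 → MvPolynomial (Fin 3) ℝ}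
    (hv : ∀ i, (v i).totalDegree ≤ k + 1) (i : Fin 3) : (curl v i).totalDegree ≤ k := by
  fin_cases i <;>
    exact totalDegree_sub_le (totalDegree_pderiv_le (hv _) _) (totalDegree_pderiv_le (hv _) _)

namespace Mesh

variable {𝒯 : Mesh} {k : ℕ}

theorem IsLocalRT.totalDegree_le {f : VectorField 𝒯} (h : 𝒯.IsLocalRT k f) (K : Fin 𝒯.n)
    (i : Fin 3) : (f K i).totalDegree ≤ k + 1 := by
  obtain ⟨p, q, hp, hq, hf⟩ := h K
  rw [hf]
  refine totalDegree_add_le ((hp i).trans k.le_succ) ?_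
  rw [Pi.smul_apply, smul_eq_mul, mul_comm]
  exact totalDegree_mul_X_le hq i

theorem totalDegree_le_of_mem_NedZero {f : VectorField 𝒯} (h : f ∈ 𝒯.NedZero k) (K : Fin 𝒯.n)
    (i : Fin 3) : (f K i).totalDegree ≤ k + 1 := by
  obtain ⟨p, q, hp, hq, hf⟩ := h.1 K
  rw [hf]
  exact totalDegree_add_cross_le hp hq i

/-! ### The finite element spaces are subspaces -/

theorem setIntegral_add_mul_test {g g' : Space → ℝ} (hg : MemLp g 2 (volume.restrict 𝒯.domain))
    (hg' : MemLp g' 2 (volume.restrict 𝒯.domain)) {ψ : Space → ℝ} (hψ : IsTest ψ) :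
    ∫ x in 𝒯.domain, (g + g') x * ψ x =
      (∫ x in 𝒯.domain, g x * ψ x) + ∫ x in 𝒯.domain, g' x * ψ x := by
  rw [← MeasureTheory.integral_add (integrableOn_mul_test hg hψ) (integrableOn_mul_test hg' hψ)]
  simp [add_mul]

theorem setIntegral_smul_mul_test (a : ℝ) (g ψ : Space → ℝ) :
    ∫ x in 𝒯.domain, (a • g) x * ψ x = a * ∫ x in 𝒯.domain, g x * ψ x := by
  rw [← MeasureTheory.integral_const_mul]
  simp [mul_assoc]

theorem continuous_gradT {ψ : Space → ℝ} (h : IsTest ψ) : Continuous (gradT ψ) :=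
  continuous_pi fun i => (h.partialD i).continuous

/-- The functional `f ↦ ∫ f · ∇ψ`. -/
def pairGradT {ψ : Space → ℝ} (h : IsTest ψ) : VectorField 𝒯 →ₗ[ℝ] ℝ :=
  pairV (fun _ => gradT ψ) fun _ => (continuous_gradT h).continuousOn

theorem pairGradT_apply {ψ : Space → ℝ} (h : IsTest ψ) (f : VectorField 𝒯) :
    pairGradT h f = 𝒯.integral fun K x => evV (f K) x ⬝ᵥ gradT ψ x := rfl

variable (𝒯 k)

/-- `DG_k` as a subspace. -/
def DGSub : Submodule ℝ (ScalarField 𝒯) where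
  carrier := 𝒯.DG k
  add_mem' hf hg K := totalDegree_add_le (hf K) (hg K)
  zero_mem' K := by simp
  smul_mem' a f hf K := (MvPolynomial.totalDegree_smul_le a (f K)).trans (hf K)

/-- `Q_k` with vanishing boundary values as a subspace. -/
def QZeroSub : Submodule ℝ (ScalarField 𝒯) where
  carrier := 𝒯.QZero k
  add_mem' := by
    rintro f f' ⟨hf, g, hg, H⟩ ⟨hf', g', hg', H'⟩
    refine ⟨fun K => totalDegree_add_le (hf K) (hf' K), g + g',
      fun i => (hg i).add (hg' i), fun ψ hψ i => ?_⟩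
    have := (pairS (𝒯 := 𝒯) (fun _ => partialD i ψ)
      fun _ => (hψ.partialD i).continuous.continuousOn).map_add f f'
    refine this.trans ?_
    change 𝒯.integral (fun K x => ev (f K) x * partialD i ψ x) +
      𝒯.integral (fun K x => ev (f' K) x * partialD i ψ x) = _
    rw [H ψ hψ, H' ψ hψ, Pi.add_apply, setIntegral_add_mul_test (hg i) (hg' i) hψ, neg_add]
  zero_mem' := ⟨fun K => by simp, 0, fun i => MemLp.zero, fun ψ hψ i => by simp [integral_zero]⟩
  smul_mem' := by
    rintro a f ⟨hf, g, hg, H⟩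
    refine ⟨fun K => (MvPolynomial.totalDegree_smul_le a (f K)).trans (hf K), a • g,
      fun i => (hg i).const_smul a, fun ψ hψ i => ?_⟩
    have := (pairS (𝒯 := 𝒯) (fun _ => partialD i ψ)
      fun _ => (hψ.partialD i).continuous.continuousOn).map_smul a f
    refine this.trans ?_
    change a * 𝒯.integral (fun K x => ev (f K) x * partialD i ψ x) = _
    rw [H ψ hψ, Pi.smul_apply, setIntegral_smul_mul_test, mul_neg]

variable {𝒯 k}

theorem IsLocalRT.add {f f' : VectorField 𝒯} (h : 𝒯.IsLocalRT k f) (h' : 𝒯.IsLocalRT k f') :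
    𝒯.IsLocalRT k (f + f') := fun K => by
  obtain ⟨p, q, hp, hq, hf⟩ := h K
  obtain ⟨p', q', hp', hq', hf'⟩ := h' K
  refine ⟨p + p', q + q', fun i => totalDegree_add_le (hp i) (hp' i), totalDegree_add_le hq hq', ?_⟩
  rw [Pi.add_apply, hf, hf', add_smul]
  abel

theorem IsLocalRT.smul (a : ℝ) {f : VectorField 𝒯} (h : 𝒯.IsLocalRT k f) :
    𝒯.IsLocalRT k (a • f) := fun K => by
  obtain ⟨p, q, hp, hq, hf⟩ := h K
  refine ⟨a • p, a • q, fun i => (MvPolynomial.totalDegree_smul_le a (p i)).trans (hp i),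
    (MvPolynomial.totalDegree_smul_le a q).trans hq, ?_⟩
  rw [Pi.smul_apply, hf, smul_add, smul_assoc]

theorem isLocalRT_zero : 𝒯.IsLocalRT k 0 :=
  fun K => ⟨0, 0, fun i => by simp, by simp, by simp⟩

theorem green_add {f f' : VectorField 𝒯} {g g' : Space → ℝ}
    (hg : MemLp g 2 (volume.restrict 𝒯.domain)) (hg' : MemLp g' 2 (volume.restrict 𝒯.domain))
    {ψ : Space → ℝ} (hψ : IsTest ψ)
    (h : 𝒯.integral (fun K x => evV (f K) x ⬝ᵥ gradT ψ x) = - ∫ x in 𝒯.domain, g x * ψ x)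
    (h' : 𝒯.integral (fun K x => evV (f' K) x ⬝ᵥ gradT ψ x) = - ∫ x in 𝒯.domain, g' x * ψ x) :
    𝒯.integral (fun K x => evV ((f + f') K) x ⬝ᵥ gradT ψ x) =
      - ∫ x in 𝒯.domain, (g + g') x * ψ x := by
  rw [← pairGradT_apply hψ] at h h' ⊢
  rw [map_add, h, h', setIntegral_add_mul_test hg hg' hψ, neg_add]

theorem green_smul (a : ℝ) {f : VectorField 𝒯} {g ψ : Space → ℝ} (hψ : IsTest ψ)
    (h : 𝒯.integral (fun K x => evV (f K) x ⬝ᵥ gradT ψ x) = - ∫ x in 𝒯.domain, g x * ψ x) :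
    𝒯.integral (fun K x => evV ((a • f) K) x ⬝ᵥ gradT ψ x) =
      - ∫ x in 𝒯.domain, (a • g) x * ψ x := by
  rw [← pairGradT_apply hψ] at h ⊢
  rw [map_smul, h, setIntegral_smul_mul_test, smul_eq_mul, mul_neg]

theorem green_zero (ψ : Space → ℝ) :
    𝒯.integral (fun K x => evV ((0 : VectorField 𝒯) K) x ⬝ᵥ gradT ψ x) =
      - ∫ x in 𝒯.domain, (0 : Space → ℝ) x * ψ x := by
  simp [integral_zero]

variable (𝒯 k)

/-- `RT_k` as a subspace. -/
def RTSub : Submodule ℝ (VectorField 𝒯) where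
  carrier := 𝒯.RT k
  add_mem' := by
    rintro f f' ⟨hf, g, hg, H⟩ ⟨hf', g', hg', H'⟩
    exact ⟨hf.add hf', g + g', hg.add hg',
      fun ψ hψ hs => green_add hg hg' hψ (H ψ hψ hs) (H' ψ hψ hs)⟩
  zero_mem' := ⟨isLocalRT_zero, 0, MemLp.zero, fun ψ _ _ => green_zero ψ⟩
  smul_mem' := by
    rintro a f ⟨hf, g, hg, H⟩
    exact ⟨hf.smul a, a • g, hg.const_smul a, fun ψ hψ hs => green_smul a hψ (H ψ hψ hs)⟩

/-- `RT_k` with vanishing normal component on the boundary as a subspace. -/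
def RTZeroSub : Submodule ℝ (VectorField 𝒯) where
  carrier := 𝒯.RTZero k
  add_mem' := by
    rintro f f' ⟨hf, g, hg, H⟩ ⟨hf', g', hg', H'⟩
    exact ⟨hf.add hf', g + g', hg.add hg',
      fun ψ hψ => green_add hg hg' hψ (H ψ hψ) (H' ψ hψ)⟩
  zero_mem' := ⟨isLocalRT_zero, 0, MemLp.zero, fun ψ _ => green_zero ψ⟩
  smul_mem' := by
    rintro a f ⟨hf, g, hg, H⟩
    exact ⟨hf.smul a, a • g, hg.const_smul a, fun ψ hψ => green_smul a hψ (H ψ hψ)⟩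

variable {𝒯 k}

/-! ### The discrete de Rham complex -/

theorem pderiv_comm (i j : Fin 3) (p : MvPolynomial (Fin 3) ℝ) :
    MvPolynomial.pderiv i (MvPolynomial.pderiv j p) =
      MvPolynomial.pderiv j (MvPolynomial.pderiv i p) := by
  ext d
  simp only [MvPolynomial.coeff_pderiv, add_right_comm d]
  rcases eq_or_ne i j with rfl | h
  · rfl
  · simp [Finsupp.single_eq_of_ne h, Finsupp.single_eq_of_ne h.symm]
    ring

theorem curl_grad (p : MvPolynomial (Fin 3) ℝ) : curl (grad p) = 0 := by
  funext i
  fin_cases i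
  · exact sub_eq_zero.2 (pderiv_comm 1 2 p)
  · exact sub_eq_zero.2 (pderiv_comm 2 0 p)
  · exact sub_eq_zero.2 (pderiv_comm 0 1 p)

theorem div_curl (v : Fin 3 → MvPolynomial (Fin 3) ℝ) : div (curl v) = 0 := by
  simp only [div, curl, Fin.sum_univ_three, Matrix.cons_val_zero, Matrix.cons_val_one,
    Matrix.cons_val, map_sub]
  rw [pderiv_comm 0 1, pderiv_comm 0 2, pderiv_comm 1 2]
  ring

theorem isTest_curlT {ψ : Fin 3 → Space → ℝ} (h : ∀ i, IsTest (ψ i)) (i : Fin 3) :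
    IsTest (fun x => curlT ψ x i) := by
  fin_cases i <;> exact ((h _).partialD _).sub ((h _).partialD _)

theorem div_curlT {ψ : Fin 3 → Space → ℝ} (h : ∀ i, IsTest (ψ i)) (x : Space) :
    ∑ i, partialD i (fun y => curlT ψ y i) x = 0 := by
  have key : ∀ a i j i' j', partialD a (fun y => partialD i (ψ j) y - partialD i' (ψ j') y) x =
      partialD a (partialD i (ψ j)) x - partialD a (partialD i' (ψ j')) x := fun a i j i' j' =>
    partialD_sub ((h _).partialD _) ((h _).partialD _) a x
  simp only [Fin.sum_univ_three, curlT, Matrix.cons_val_zero, Matrix.cons_val_one,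
    Matrix.cons_val, key]
  rw [partialD_comm (h 2) 0 1, partialD_comm (h 1) 0 2, partialD_comm (h 0) 1 2]
  ring

theorem curlT_gradT {ψ : Space → ℝ} (h : IsTest ψ) (x : Space) :
    curlT (fun i => partialD i ψ) x = 0 := by
  funext i
  fin_cases i
  · exact sub_eq_zero.2 (partialD_comm h 1 2 x)
  · exact sub_eq_zero.2 (partialD_comm h 2 0 x)
  · exact sub_eq_zero.2 (partialD_comm h 0 1 x)

/-- Green's formula for `φ` moves the gradient onto `curl ψ`, and `div curl ψ = 0`; hence the zero
field serves as the weak curl, boundary condition included. The Gauss law uses this to test Ampère's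
equation with `∇φ`. -/
theorem grad_mem_NedZero {φ : ScalarField 𝒯} (h : φ ∈ 𝒯.QZero (k + 1)) :
    (fun K => grad (φ K)) ∈ 𝒯.NedZero k := by
  refine ⟨fun K => ⟨grad (φ K), 0, fun i => totalDegree_pderiv_le (h.1 K) i, fun i => by simp,
    by simp⟩, 0, fun i => MemLp.zero, fun ψ hψ => ?_⟩
  have hc : ∀ (p : MvPolynomial (Fin 3) ℝ) (χ : Space → ℝ) (s : Set Space), IsTest χ →
      ContinuousOn (fun x => ev p x * χ x) s := fun p χ s hχ =>
    ((continuous_ev p).mul hχ.continuous).continuousOn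
  have key : ∀ i, 𝒯.integral (fun K x => ev (MvPolynomial.pderiv i (φ K)) x * curlT ψ x i) =
      - 𝒯.integral (fun K x => ev (φ K) x * partialD i (fun y => curlT ψ y i) x) := fun i => by
    rw [h.2.green (isTest_curlT hψ i) i, neg_neg]
  have h1 : 𝒯.integral (fun K x => evV (grad (φ K)) x ⬝ᵥ curlT ψ x) =
      ∑ i, 𝒯.integral fun K x => ev (MvPolynomial.pderiv i (φ K)) x * curlT ψ x i :=
    integral_finsetSum fun i K => hc _ _ _ (isTest_curlT hψ i)
  have h2 : 𝒯.integral (fun K x => ∑ i, ev (φ K) x * partialD i (fun y => curlT ψ y i) x) =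
      ∑ i, 𝒯.integral fun K x => ev (φ K) x * partialD i (fun y => curlT ψ y i) x :=
    integral_finsetSum fun i K => hc _ _ _ ((isTest_curlT hψ i).partialD i)
  simp only [← Finset.mul_sum, div_curlT hψ, mul_zero, integral_zero] at h2
  rw [h1]
  simp only [key, Finset.sum_neg_distrib, ← h2]
  simp

/-- Green's formula for `E` with test field `∇ψ`, whose curl vanishes. It serves twice: for
`curl_mem_RTZero` and for the weak divergence of `B`. -/
theorem integral_curl_dotProduct_gradT {E : VectorField 𝒯} (h : E ∈ 𝒯.NedZero k) {ψ : Space → ℝ}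
    (hψ : IsTest ψ) : 𝒯.integral (fun K x => evV (curl (E K)) x ⬝ᵥ gradT ψ x) = 0 := by
  have := h.2.green fun i => hψ.partialD i
  rw [show 𝒯.integral (fun K x => evV (curl (E K)) x ⬝ᵥ gradT ψ x) = _ from this.symm]
  simp [curlT_gradT hψ, integral_zero]

/-- Puts the right-hand side of Faraday's equation into its own test space. The local degree is at
most `k + 1` and the curl lowers it by one, so no summand `x q` is needed. -/
theorem curl_mem_RTZero {E : VectorField 𝒯} (h : E ∈ 𝒯.NedZero k) :
    (fun K => curl (E K)) ∈ 𝒯.RTZero k := by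
  refine ⟨fun K => ⟨curl (E K), 0,
    totalDegree_curl_le (totalDegree_le_of_mem_NedZero h K), by simp, by simp⟩,
    0, MemLp.zero, fun ψ hψ => ?_⟩
  simp [integral_curl_dotProduct_gradT h hψ]

/-! ### Positivity and the discrete weak divergence -/

theorem finiteDimensional_QZeroSub : FiniteDimensional ℝ (𝒯.QZeroSub k) := by
  have hle : 𝒯.QZeroSub k ≤ Submodule.span ℝ (Set.range fun s : Fin 𝒯.n × expBox k =>
      (Pi.single s.1 (MvPolynomial.monomial (s.2 : Fin 3 →₀ ℕ) (1 : ℝ)) : ScalarField 𝒯)) := by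
    intro f hf
    rw [scalarField_eq_sum k hf.1]
    exact Submodule.sum_mem _ fun s _ =>
      Submodule.smul_mem _ _ (Submodule.subset_span (mem_range_self s))
  have : FiniteDimensional ℝ (Submodule.span ℝ (Set.range fun s : Fin 𝒯.n × expBox k =>
      (Pi.single s.1 (MvPolynomial.monomial (s.2 : Fin 3 →₀ ℕ) (1 : ℝ)) : ScalarField 𝒯))) :=
    FiniteDimensional.span_of_finite ℝ (Set.finite_range _)
  exact Submodule.finiteDimensional_of_le hle

/-- `φ ↦ ∇φ`, cell by cell. -/
def gradₗ : ScalarField 𝒯 →ₗ[ℝ] VectorField 𝒯 where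
  toFun φ K := grad (φ K)
  map_add' φ φ' := by ext1 K; ext1 i; simp [grad]
  map_smul' a φ := by ext1 K; ext1 i; simp [grad]

/-- Riesz representation in finite dimension: a definite form gives an injective map into the dual,
hence a bijective one. The field `E` enters only through the functional to be represented. -/
theorem existsUnique_isWeakDiv (E : VectorField 𝒯) : ∃! D, 𝒯.IsWeakDiv k E D := by
  have hfin := finiteDimensional_QZeroSub (𝒯 := 𝒯) (k := k + 1)
  set W := 𝒯.QZeroSub (k + 1)
  let B : W →ₗ[ℝ] Module.Dual ℝ W := (innerS (𝒯 := 𝒯)).compl₁₂ W.subtype W.subtype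
  have hB : ∀ f g : W, B f g = innerS (f : ScalarField 𝒯) (g : ScalarField 𝒯) := fun f g => rfl
  have hinj : Function.Injective B := by
    rw [injective_iff_map_eq_zero]
    intro f hf
    have : innerS (f : ScalarField 𝒯) (f : ScalarField 𝒯) = 0 := by rw [← hB, hf]; rfl
    exact Subtype.ext (eq_zero_of_innerS_self this)
  have hsurj : Function.Surjective B :=
    (LinearMap.injective_iff_surjective_of_finrank_eq_finrank Subspace.dual_finrank_eq.symm).1 hinj
  obtain ⟨D, hD⟩ := hsurj (-((innerV E).comp gradₗ).comp W.subtype)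
  refine ⟨D, ⟨D.2, fun φ hφ => ?_⟩, fun D' hD' => ?_⟩
  · exact LinearMap.congr_fun hD (⟨φ, hφ⟩ : W)
  · have : B ⟨D', hD'.1⟩ = B D := by
      rw [hD]
      ext φ
      exact hD'.2 φ φ.2
    exact congrArg Subtype.val (hinj this)

end Mesh

/-! ### Lipschitz continuity of conforming piecewise polynomials -/

theorem fderiv_apply_eq_sum (η : Space → ℝ) (z v : Space) :
    fderiv ℝ η z v = ∑ i, v i * partialD i η z := by
  conv_lhs => rw [← (EuclideanSpace.basisFun (Fin 3) ℝ).sum_repr v]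
  simp [partialD]

theorem partialD_comp_sub {η : Space → ℝ} (h : IsTest η) (x y : Space) (i : Fin 3) :
    partialD i (fun z => η (x - z)) y = - partialD i η (x - y) := by
  have h1 : HasFDerivAt (fun z => η (x - z)) _ y :=
    (h.differentiable (x - y)).hasFDerivAt.comp y ((hasFDerivAt_id y).const_sub x)
  simp [partialD, h1.fderiv]

theorem IsTest.comp_sub {η : Space → ℝ} (h : IsTest η) (x : Space) :
    IsTest (fun z => η (x - z)) :=
  ⟨h.1.comp (contDiff_const.sub contDiff_id),
    h.2.comp_homeomorph (Homeomorph.subLeft x)⟩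

namespace Mesh

variable {𝒯 : Mesh}

/-- The extension by zero of a piecewise polynomial function. -/
def extend (f : ScalarField 𝒯) (x : Space) : ℝ :=
  ∑ K, (𝒯.cell K).indicator (ev (f K)) x

theorem integrable_extend (f : ScalarField 𝒯) : Integrable (extend f) :=
  integrable_finsetSum _ fun K _ =>
    (integrableOn_cell (continuous_ev (f K)).continuousOn).integrable_indicator
      (𝒯.measurableSet_cell K)

/-- Restricted to interior points because on a common face the sum in `extend` counts every adjacent
cell. -/
theorem extend_eq (f : ScalarField 𝒯) {K : Fin 𝒯.n} {x : Space} (hx : x ∈ interior (𝒯.cell K)) :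
    extend f x = ev (f K) x := by
  rw [extend, Finset.sum_eq_single K]
  · exact indicator_of_mem (interior_subset hx) _
  · intro L _ hL
    exact indicator_of_notMem (fun h => (disjoint_interior_cell hL.symm).le_bot ⟨hx, h⟩) _
  · simp

theorem integral_extend_mul (f : ScalarField 𝒯) {h : Space → ℝ} (hh : Continuous h) :
    ∫ x, extend f x * h x = 𝒯.integral fun K x => ev (f K) x * h x := by
  have e : ∀ x, extend f x * h x =
      ∑ K, (𝒯.cell K).indicator (fun x => ev (f K) x * h x) x := fun x => by
    rw [extend, Finset.sum_mul]
    exact Finset.sum_congr rfl fun K _ => (indicator_mul_left _ _ _).symm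
  simp only [e]
  refine (MeasureTheory.integral_finsetSum _ fun K _ => (integrableOn_cell
    (F := fun x => ev (f K) x * h x)
    ((continuous_ev (f K)).mul hh).continuousOn).integrable_indicator
      (𝒯.measurableSet_cell K)).trans ?_
  exact Finset.sum_congr rfl fun K _ => integral_indicator (𝒯.measurableSet_cell K)

theorem exists_bound_ev {ι : Type*} [Fintype ι] (p : Fin 𝒯.n → ι → MvPolynomial (Fin 3) ℝ) :
    ∃ C, 0 ≤ C ∧ ∀ K i, ∀ x ∈ 𝒯.cell K, |ev (p K i) x| ≤ C := by
  have h : ∀ s : Fin 𝒯.n × ι, ∃ C, ∀ x ∈ 𝒯.cell s.1, ‖ev (p s.1 s.2) x‖ ≤ C := fun s =>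
    (𝒯.isCompact_cell s.1).exists_bound_of_continuousOn (continuous_ev _).continuousOn
  choose C hC using h
  refine ⟨∑ s, |C s|, Finset.sum_nonneg fun s _ => abs_nonneg _, fun K i x hx => ?_⟩
  exact (hC (K, i) x hx).trans ((le_abs_self _).trans
    (Finset.single_le_sum (f := fun s => |C s|) (fun s _ => abs_nonneg _) (Finset.mem_univ (K, i))))

/-- A mollification of an `H¹` function with zero boundary values, extended by zero, is Lipschitz
with a constant that bounds the cellwise gradients. -/
theorem MemH1Zero.abs_mollify_sub_le {f : ScalarField 𝒯} (hf : 𝒯.MemH1Zero f) {C : ℝ} (hC : 0 ≤ C)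
    (hb : ∀ K i, ∀ x ∈ 𝒯.cell K, |ev (MvPolynomial.pderiv i (f K)) x| ≤ C) {η : Space → ℝ}
    (hη : IsTest η) (h0 : ∀ x, 0 ≤ η x) (h1 : ∫ x, η x = 1) (x y : Space) :
    |(∫ z, extend f z * η (x - z)) - ∫ z, extend f z * η (y - z)| ≤ 3 * C * ‖x - y‖ := by
  set L := ContinuousLinearMap.mul ℝ ℝ
  have hG : ∀ x, HasFDerivAt (fun x => ∫ z, extend f z * η (x - z))
      ((convolution (extend f) (fderiv ℝ η) (L.precompR Space) volume) x) x := fun x =>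
    hη.2.hasFDerivAt_convolution_right L (integrable_extend f).locallyIntegrable
      (hη.1.of_le (by simp)) x
  have hbound : ∀ x v, |((convolution (extend f) (fderiv ℝ η) (L.precompR Space) volume) x) v| ≤
      3 * C * ‖v‖ := fun x v => by
    have hdη : Continuous (fderiv ℝ η) := hη.1.continuous_fderiv (by simp)
    rw [convolution_precompR_apply L (integrable_extend f).locallyIntegrable
      (hη.2.fderiv ℝ) hdη]
    have e1 : (convolution (extend f) (fun a => fderiv ℝ η a v) L volume) x =
        𝒯.integral fun K z => ev (f K) z * fderiv ℝ η (x - z) v := by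
      rw [← integral_extend_mul f (h := fun z => fderiv ℝ η (x - z) v)
        ((hdη.comp (continuous_const.sub continuous_id)).clm_apply continuous_const)]
      rfl
    have hχ := hη.comp_sub x
    -- The derivative passes from the mollifier to `f` by Green's formula; conformity and zero
    -- boundary values enter here. The sign from differentiating `η (x - z)` in `z` cancels the sign
    -- in Green's formula.
    have e2 : (𝒯.integral fun K z => ev (f K) z * fderiv ℝ η (x - z) v) =
        ∑ i, v i * 𝒯.integral fun K z => ev (MvPolynomial.pderiv i (f K)) z * η (x - z) := by
      have e3 : ∀ K z, ev (f K) z * fderiv ℝ η (x - z) v =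
          ∑ i, (-v i) * (ev (f K) z * partialD i (fun z => η (x - z)) z) := fun K z => by
        rw [fderiv_apply_eq_sum, Finset.mul_sum]
        refine Finset.sum_congr rfl fun i _ => ?_
        rw [partialD_comp_sub hη]
        ring
      simp only [e3]
      refine (integral_finsetSum
        (F := fun i K z => (-v i) * (ev (f K) z * partialD i (fun z => η (x - z)) z))
        fun i K => (continuous_const.mul
          ((continuous_ev _).mul (hχ.partialD i).continuous)).continuousOn).trans ?_
      refine Finset.sum_congr rfl fun i _ => ?_
      rw [integral_const_mul, hf.green hχ i, neg_mul_neg]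
    have hle : ∀ i, |𝒯.integral fun K z => ev (MvPolynomial.pderiv i (f K)) z * η (x - z)| ≤ C := by
      intro i
      have hint : Integrable fun z => η (x - z) := hχ.continuous.integrable_of_hasCompactSupport hχ.2
      calc |𝒯.integral fun K z => ev (MvPolynomial.pderiv i (f K)) z * η (x - z)|
          ≤ ∑ K, |∫ z in 𝒯.cell K, ev (MvPolynomial.pderiv i (f K)) z * η (x - z)| :=
            Finset.abs_sum_le_sum_abs _ _
        _ ≤ ∑ K, ∫ z in 𝒯.cell K, C * η (x - z) := by
            refine Finset.sum_le_sum fun K _ => ?_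
            refine (abs_integral_le_integral_abs).trans (setIntegral_mono_on
              (integrableOn_cell ((continuous_ev _).mul hχ.continuous).abs.continuousOn)
              (hint.const_mul C).integrableOn (𝒯.measurableSet_cell K) fun z hz => ?_)
            rw [abs_mul, abs_of_nonneg (h0 _)]
            exact mul_le_mul_of_nonneg_right (hb K i z hz) (h0 _)
        _ = ∫ z in 𝒯.domain, C * η (x - z) :=
            (setIntegral_domain (hint.const_mul C).integrableOn).symm
        _ ≤ ∫ z, C * η (x - z) :=
            setIntegral_le_integral (hint.const_mul C)
              (ae_of_all _ fun z => mul_nonneg hC (h0 _))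
        _ = C := by
            rw [MeasureTheory.integral_const_mul, integral_sub_left_eq_self η volume x, h1, mul_one]
    rw [e1, e2]
    -- The factor `3` comes from bounding each of the three components of `v` by `‖v‖`.
    calc |∑ i, v i * 𝒯.integral fun K z => ev (MvPolynomial.pderiv i (f K)) z * η (x - z)|
        ≤ ∑ i : Fin 3, ‖v‖ * C := by
          refine (Finset.abs_sum_le_sum_abs _ _).trans (Finset.sum_le_sum fun i _ => ?_)
          rw [abs_mul]
          exact mul_le_mul (PiLp.norm_apply_le v i) (hle i) (abs_nonneg _) (norm_nonneg _)
      _ = 3 * C * ‖v‖ := by simp; ring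
  -- The mean value inequality is applied on all of space: the segment from `y` to `x` may leave the
  -- domain, which is why `f` was extended by zero.
  have := convex_univ.norm_image_sub_le_of_norm_hasFDerivWithin_le (C := 3 * C)
    (fun x _ => (hG x).hasFDerivWithinAt)
    (fun x _ => ContinuousLinearMap.opNorm_le_bound _ (by positivity) (hbound x))
    (mem_univ y) (mem_univ x)
  exact this

theorem tendsto_mollify (f : ScalarField 𝒯) {φ : ℕ → ContDiffBump (0 : Space)}
    (hφ : Tendsto (fun n => (φ n).rOut) atTop (𝓝 0)) {K : Fin 𝒯.n} {x : Space}
    (hx : x ∈ interior (𝒯.cell K)) :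
    Tendsto (fun n => ∫ z, extend f z * (φ n).normed volume (x - z)) atTop (𝓝 (ev (f K) x)) := by
  have h1 : Tendsto (extend f) (𝓝 x) (𝓝 (ev (f K) x)) := by
    refine ((continuous_ev (f K)).tendsto x).congr' ?_
    filter_upwards [isOpen_interior.mem_nhds hx] with y hy
    exact (extend_eq f hy).symm
  refine (ContDiffBump.convolution_tendsto_right (μ := volume) (g := fun _ => extend f)
    hφ (Eventually.of_forall fun _ => (integrable_extend f).aestronglyMeasurable)
    (h1.comp tendsto_snd) (tendsto_const_nhds (x := x))).congr fun n => ?_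
  rw [convolution_lsmul_swap]
  exact integral_congr_ae (ae_of_all _ fun z => mul_comm _ _)

theorem exists_contDiffBump_tendsto :
    ∃ φ : ℕ → ContDiffBump (0 : Space), Tendsto (fun n => (φ n).rOut) atTop (𝓝 0) := by
  refine ⟨fun n => ⟨1 / ((n : ℝ) + 1), 2 * (1 / ((n : ℝ) + 1)), by positivity,
    lt_mul_of_one_lt_left (by positivity) one_lt_two⟩, ?_⟩
  have := (tendsto_one_div_add_atTop_nhds_zero_nat (𝕜 := ℝ)).const_mul 2
  rwa [mul_zero] at this

/-- Piecewise polynomials in `H¹` with zero boundary values are Lipschitz across the cells; in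
particular their values from different cells agree at common points. -/
theorem MemH1Zero.exists_lipschitz {f : ScalarField 𝒯} (hf : 𝒯.MemH1Zero f) :
    ∃ C, 0 ≤ C ∧ ∀ K L, ∀ x ∈ 𝒯.cell K, ∀ y ∈ 𝒯.cell L,
      |ev (f K) x - ev (f L) y| ≤ C * ‖x - y‖ := by
  obtain ⟨C, hC, hb⟩ := exists_bound_ev (𝒯 := 𝒯) fun K i => MvPolynomial.pderiv i (f K)
  obtain ⟨φ, hφ⟩ := exists_contDiffBump_tendsto
  refine ⟨3 * C, by positivity, fun K L x hx y hy => ?_⟩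
  -- The Lipschitz constant does not depend on the mollifier, so it survives the limit at interior
  -- points; density of the interiors then reaches the closed cells, one variable at a time.
  have hint : ∀ x ∈ interior (𝒯.cell K), ∀ y ∈ interior (𝒯.cell L),
      |ev (f K) x - ev (f L) y| ≤ 3 * C * ‖x - y‖ := fun x hx y hy =>
    le_of_tendsto' ((tendsto_mollify f hφ hx).sub (tendsto_mollify f hφ hy)).abs fun n =>
      hf.abs_mollify_sub_le hC hb ⟨(φ n).contDiff_normed, (φ n).hasCompactSupport_normed⟩
        (φ n).nonneg_normed ((φ n).integral_normed) x y
  have h1 : ∀ y ∈ interior (𝒯.cell L), |ev (f K) x - ev (f L) y| ≤ 3 * C * ‖x - y‖ := by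
    intro y hy
    refine closure_minimal (t := {x | |ev (f K) x - ev (f L) y| ≤ 3 * C * ‖x - y‖})
      (fun x hx => hint x hx y hy) (isClosed_le ?_ ?_) (𝒯.cell_subset_closure_interior K hx)
    · exact ((continuous_ev _).sub continuous_const).abs
    · exact continuous_const.mul (continuous_id.sub continuous_const).norm
  refine closure_minimal (t := {y | |ev (f K) x - ev (f L) y| ≤ 3 * C * ‖x - y‖})
    (fun y hy => h1 y hy) (isClosed_le ?_ ?_) (𝒯.cell_subset_closure_interior L hy)
  · exact (continuous_const.sub (continuous_ev _)).abs
  · exact continuous_const.mul (continuous_const.sub continuous_id).norm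

theorem MemH1Zero.ev_eq {f : ScalarField 𝒯} (hf : 𝒯.MemH1Zero f) {K L : Fin 𝒯.n} {x : Space}
    (hK : x ∈ 𝒯.cell K) (hL : x ∈ 𝒯.cell L) : ev (f K) x = ev (f L) x := by
  obtain ⟨C, -, hC⟩ := hf.exists_lipschitz
  have := hC K L x hK x hL
  rw [sub_self, norm_zero, mul_zero] at this
  exact sub_eq_zero.1 (abs_nonpos_iff.1 this)

end Mesh

/-! ### Differentiation along particle paths -/

/-- The points of a set that are not accumulation points of it form a countable set. -/
theorem countable_setOf_not_accPt (A : Set ℝ) : {t ∈ A | ¬ AccPt t (𝓟 A)}.Countable := by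
  have : DiscreteTopology ({t ∈ A | ¬ AccPt t (𝓟 A)} : Set ℝ) := by
    refine discreteTopology_subtype_iff.2 fun t ht => ?_
    have h := not_neBot.1 ht.2
    exact le_bot_iff.1 (h ▸ inf_le_inf_left _ (principal_mono.2 fun s hs => hs.1))
  exact TopologicalSpace.separableSpace_iff_countable.1 inferInstance

/-- A function that switches between finitely many branches has almost everywhere, where it is
differentiable, the derivative of the current branch. -/
theorem ae_deriv_eq_of_branches {ι : Type*} [Finite ι] (loc : ℝ → ι) (G : ι → ℝ → ℝ) :
    ∀ᵐ t, ∀ a b, HasDerivAt (fun r => G (loc r) r) a t → HasDerivAt (G (loc t)) b t → a = b := by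
  -- Off a countable set, `t` is an accumulation point of times with the same branch. On those times
  -- the two functions agree, and a derivative within such a set is unique. Nothing is assumed about
  -- `loc`.
  have h : ∀ᵐ t, ∀ i, t ∉ {t ∈ loc ⁻¹' {i} | ¬ AccPt t (𝓟 (loc ⁻¹' {i}))} :=
    ae_all_iff.2 fun i => measure_eq_zero_iff_ae_notMem.1
      ((countable_setOf_not_accPt _).measure_zero volume)
  filter_upwards [h] with t ht a b ha hb
  have hacc : AccPt t (𝓟 (loc ⁻¹' {loc t})) := by
    by_contra hn
    exact ht (loc t) ⟨rfl, hn⟩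
  refine hacc.uniqueDiffWithinAt.eq_deriv _ ha.hasDerivWithinAt
    (hb.hasDerivWithinAt.congr (fun r hr => ?_) rfl)
  rw [show loc r = loc t from hr]

theorem hasDerivAt_ev_comp (p : MvPolynomial (Fin 3) ℝ) {X : ℝ → Space} {t : ℝ} {v : Fin 3 → ℝ}
    (hX : ∀ i, HasDerivAt (fun s => X s i) (v i) t) :
    HasDerivAt (fun s => ev p (X s)) (evV (grad p) (X t) ⬝ᵥ v) t := by
  have h1 : HasDerivAt (fun s => (WithLp.toLp 2 (fun i => X s i) : Space)) (WithLp.toLp 2 v) t :=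
    (PiLp.continuousLinearEquiv 2 ℝ (fun _ : Fin 3 => ℝ)).symm.hasFDerivAt.comp_hasDerivAt t
      (hasDerivAt_pi.2 hX)
  have h2 := (hasFDerivAt_ev p (X t)).comp_hasDerivAt t h1
  refine h2.congr_deriv ?_
  simp [dotProduct, evV, grad]

/-! ### The Lorentz factor -/

/-- As a Euclidean norm in dimension four the square root is Lipschitz. The case `r = 1` is the
Lorentz factor of a particle, the case `r = ρ` the fluid energy density. -/
theorem sqrt_add_sq_eq_norm {a : ℝ} (ha : 0 < a) (r : ℝ) (u : Fin 3 → ℝ) :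
    √(r ^ 2 + u ⬝ᵥ u / a ^ 2) = ‖(!₂[r, u 0 / a, u 1 / a, u 2 / a] : EuclideanSpace ℝ (Fin 4))‖ := by
  rw [EuclideanSpace.norm_eq]
  congr 1
  simp [Fin.sum_univ_four, dotProduct, Fin.sum_univ_three, div_pow]
  field_simp
  ring

theorem euclidean_norm_le_sum_abs {n : ℕ} (z : EuclideanSpace ℝ (Fin n)) : ‖z‖ ≤ ∑ i, |z i| := by
  conv_lhs => rw [← (EuclideanSpace.basisFun (Fin n) ℝ).sum_repr z]
  refine (norm_sum_le _ _).trans (Finset.sum_le_sum fun i _ => ?_)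
  simp [norm_smul]

theorem abs_sqrt_sub_sqrt_le {a : ℝ} (ha : 0 < a) (r r' : ℝ) (u u' : Fin 3 → ℝ) :
    |√(r ^ 2 + u ⬝ᵥ u / a ^ 2) - √(r' ^ 2 + u' ⬝ᵥ u' / a ^ 2)| ≤
      |r - r'| + a⁻¹ * ∑ i, |u i - u' i| := by
  rw [sqrt_add_sq_eq_norm ha, sqrt_add_sq_eq_norm ha]
  refine (abs_norm_sub_norm_le _ _).trans ((euclidean_norm_le_sum_abs _).trans (le_of_eq ?_))
  simp only [Fin.sum_univ_four, Fin.sum_univ_three, PiLp.sub_apply]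
  simp [← sub_div, abs_div, abs_of_pos ha]
  ring

theorem gam_pos (m c : ℝ) (u : Fin 3 → ℝ) : 0 < gam m c u :=
  Real.sqrt_pos.2 (add_pos_of_pos_of_nonneg one_pos
    (div_nonneg (Finset.sum_nonneg fun i _ => mul_self_nonneg _) (by positivity)))

theorem abs_gam_sub_gam_le {m c : ℝ} (hm : 0 < m) (hc : 0 < c) (u u' : Fin 3 → ℝ) :
    |gam m c u - gam m c u'| ≤ (m * c)⁻¹ * ∑ i, |u i - u' i| := by
  have := abs_sqrt_sub_sqrt_le (mul_pos hm hc) 1 1 u u'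
  simpa [gam, mul_pow] using this

theorem hasDerivAt_dotProduct_self {u : ℝ → Fin 3 → ℝ} {u' : Fin 3 → ℝ} {t : ℝ}
    (hu : ∀ i, HasDerivAt (fun s => u s i) (u' i) t) :
    HasDerivAt (fun s => u s ⬝ᵥ u s) (2 * (u t ⬝ᵥ u')) t := by
  refine (HasDerivAt.fun_sum fun i (_ : i ∈ Finset.univ) => (hu i).mul (hu i)).congr_deriv ?_
  rw [dotProduct, Finset.mul_sum]
  exact Finset.sum_congr rfl fun i _ => by ring

theorem hasDerivAt_gam {m c : ℝ} {u : ℝ → Fin 3 → ℝ} {u' : Fin 3 → ℝ} {t : ℝ}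
    (hu : ∀ i, HasDerivAt (fun s => u s i) (u' i) t) :
    HasDerivAt (fun s => gam m c (u s)) (u t ⬝ᵥ u' / (m ^ 2 * c ^ 2 * gam m c (u t))) t := by
  have h1 := (((hasDerivAt_dotProduct_self hu).div_const (m ^ 2 * c ^ 2)).const_add 1).sqrt
    (Real.sqrt_pos.1 (gam_pos m c (u t))).ne'
  refine h1.congr_deriv ?_
  change _ / (2 * gam m c (u t)) = _
  rw [mul_div_assoc, mul_div_mul_left _ _ two_ne_zero, div_div]

theorem fluidGam_eq {m : ℝ} (hm : 0 < m) (c r : ℝ) (M : Fin 3 → ℝ) :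
    fluidGam m c r M = √(1 + M ⬝ᵥ M / (c ^ 2 * r ^ 2)) := by
  rw [fluidGam, gam]
  congr 2
  rw [smul_dotProduct, dotProduct_smul, smul_eq_mul, smul_eq_mul]
  rcases eq_or_ne r 0 with rfl | hr
  · simp
  rcases eq_or_ne c 0 with rfl | hc
  · simp
  field_simp

/-- The factor `|r|` removes the singularity of `γ` at `r = 0`, so the increment estimates need no
lower bound on the density. -/
theorem abs_mul_fluidGam {m : ℝ} (hm : 0 < m) (c : ℝ) {r : ℝ} (hr : r ≠ 0) (M : Fin 3 → ℝ) :
    |r| * fluidGam m c r M = √(r ^ 2 + M ⬝ᵥ M / c ^ 2) := by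
  rw [fluidGam_eq hm, ← Real.sqrt_sq_eq_abs, ← Real.sqrt_mul (sq_nonneg r)]
  congr 1
  rcases eq_or_ne c 0 with rfl | hc
  · simp
  field_simp

theorem fluidGam_pos (m c r : ℝ) (M : Fin 3 → ℝ) : 0 < fluidGam m c r M := gam_pos _ _ _

/-- The increments of the fluid energy density between densities of the same sign. -/
theorem abs_energyDensity_sub_le {m c : ℝ} (hm : 0 < m) (hc : 0 < c) {r r' : ℝ} (h : 0 < r * r')
    (M M' : Fin 3 → ℝ) :
    |r * (fluidGam m c r M - 1) - r' * (fluidGam m c r' M' - 1)| ≤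
      2 * |r - r'| + c⁻¹ * ∑ i, |M i - M' i| := by
  have h1 := abs_sqrt_sub_sqrt_le hc r r' M M'
  rw [← abs_mul_fluidGam hm c (left_ne_zero_of_mul h.ne'),
    ← abs_mul_fluidGam hm c (right_ne_zero_of_mul h.ne')] at h1
  -- The common sign is essential: as `r` tends to `0` from the two sides, `r γ` tends to `± |M| /
  -- c`.
  have h2 : |r * fluidGam m c r M - r' * fluidGam m c r' M'| =
      |(|r| * fluidGam m c r M - |r'| * fluidGam m c r' M')| := by
    rcases pos_and_pos_or_neg_and_neg_of_mul_pos h with ⟨h, h'⟩ | ⟨h, h'⟩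
    · rw [abs_of_pos h, abs_of_pos h']
    · rw [abs_of_neg h, abs_of_neg h', ← abs_neg]
      ring_nf
  calc |r * (fluidGam m c r M - 1) - r' * (fluidGam m c r' M' - 1)|
      = |(r * fluidGam m c r M - r' * fluidGam m c r' M') - (r - r')| := by ring_nf
    _ ≤ |r * fluidGam m c r M - r' * fluidGam m c r' M'| + |r - r'| := abs_sub _ _
    _ ≤ _ := by rw [h2]; linarith

/-- The origin of the two projected quantities: `potential` is the partial derivative of the energy
density in `r`, and `velocity / c²` the one in `M`. -/
theorem hasDerivAt_energyDensity {m c : ℝ} (hm : 0 < m) (hc : 0 < c) {r : ℝ → ℝ} {r' : ℝ}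
    {M : ℝ → Fin 3 → ℝ} {M' : Fin 3 → ℝ} {t : ℝ} (h0 : r t ≠ 0) (hr : HasDerivAt r r' t)
    (hM : ∀ i, HasDerivAt (fun s => M s i) (M' i) t) :
    HasDerivAt (fun s => r s * (fluidGam m c (r s) (M s) - 1))
      (r' * potential m c (r t) (M t) + (M' ⬝ᵥ velocity m c (r t) (M t)) / c ^ 2) t := by
  have hγ := fluidGam_pos m c (r t) (M t)
  rw [fluidGam_eq hm] at hγ
  have h1 := (((hasDerivAt_dotProduct_self hM).fun_div ((hr.fun_pow 2).const_mul (c ^ 2))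
    (by positivity)).const_add 1).sqrt (Real.sqrt_pos.1 hγ).ne'
  have h2 := hr.mul (h1.sub_const 1)
  have h3 : (fun s => r s * (fluidGam m c (r s) (M s) - 1)) =
      r * fun s => √(1 + M s ⬝ᵥ M s / (c ^ 2 * r s ^ 2)) - 1 := by
    ext s
    rw [fluidGam_eq hm]
    rfl
  rw [h3]
  refine h2.congr_deriv ?_
  rw [potential, velocity, fluidGam_eq hm, dotProduct_smul, smul_eq_mul, dotProduct_comm M']
  set γ := √(1 + M t ⬝ᵥ M t / (c ^ 2 * r t ^ 2))
  field_simp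
  push_cast
  ring

/-! ### Differentiation under the integral sign at a single time -/

/-- The Lipschitz bound and the differentiability are asked only relative to the one time `t`, since
absolutely continuous coefficients need not be differentiable at all nearby times. -/
theorem hasDerivAt_integral_of_lip_at {α : Type*} [MeasurableSpace α] {μ : Measure α}
    [IsFiniteMeasure μ] {F : ℝ → α → ℝ} {F' : α → ℝ} {t C : ℝ} {s : Set ℝ} (hs : s ∈ 𝓝 t)
    (hF : ∀ r ∈ s, AEStronglyMeasurable (F r) μ) (hFt : Integrable (F t) μ)
    (hF' : AEStronglyMeasurable F' μ)
    (hlip : ∀ᵐ x ∂μ, ∀ r ∈ s, |F r x - F t x| ≤ C * |r - t|)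
    (hd : ∀ᵐ x ∂μ, HasDerivAt (fun r => F r x) (F' x) t) :
    HasDerivAt (fun r => ∫ x, F r x ∂μ) (∫ x, F' x ∂μ) t := by
  obtain ⟨h1, h2⟩ := hasFDerivAt_integral_of_dominated_loc_of_lip' (𝕜 := ℝ) (F := F) (x₀ := t)
    (F' := fun x => ContinuousLinearMap.toSpanSingleton ℝ (F' x)) (bound := fun _ => C) hs hF hFt
    ((ContinuousLinearMap.toSpanSingletonCLE (𝕜 := ℝ)
      (E := ℝ)).continuous.comp_aestronglyMeasurable hF')
    hlip (integrable_const C) (by filter_upwards [hd] with x hx using hx.hasFDerivAt)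
  refine h2.hasDerivAt.congr_deriv ?_
  rw [ContinuousLinearMap.integral_apply h1]
  simp

namespace Mesh

variable {𝒯 : Mesh}

/-! ### Evaluation functionals -/

/-- Evaluation of a scalar field at a point of a cell. -/
def evalS (K : Fin 𝒯.n) (x : Space) : ScalarField 𝒯 →ₗ[ℝ] ℝ where
  toFun f := ev (f K) x
  map_add' _ _ := by simp
  map_smul' _ _ := by simp

/-- Evaluation of a component of a vector field at a point of a cell. -/
def evalV (K : Fin 𝒯.n) (x : Space) (i : Fin 3) : VectorField 𝒯 →ₗ[ℝ] ℝ where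
  toFun f := ev (f K i) x
  map_add' _ _ := by simp
  map_smul' _ _ := by simp

theorem abs_map_sub_le {V : Type*} [AddCommGroup V] [Module ℝ V] {f : ℝ → V} {T : ℝ}
    (c : ACCurve f T) (ℓ : V →ₗ[ℝ] ℝ) {C : ℝ} (hC : ∀ i, |ℓ (c.vec i)| ≤ C) {s t : ℝ}
    (hs : s ∈ Icc 0 T) (ht : t ∈ Icc 0 T) :
    |ℓ (f s) - ℓ (f t)| ≤ C * ∑ i, |c.coef i s - c.coef i t| := by
  rw [c.eq s hs, c.eq t ht, ← map_sub, ← Finset.sum_sub_distrib, map_sum, Finset.mul_sum]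
  refine (Finset.abs_sum_le_sum_abs _ _).trans (Finset.sum_le_sum fun i _ => ?_)
  rw [← sub_smul, map_smul, smul_eq_mul, abs_mul, mul_comm]
  exact mul_le_mul_of_nonneg_right (hC i) (abs_nonneg _)

/-! ### Time derivative of the fluid energy -/

/-- The fluid energy, divided by `c²`. -/
def fluidEnergy (m c : ℝ) (ρ : ScalarField 𝒯) (M : VectorField 𝒯) : ℝ :=
  𝒯.integral fun K x =>
    ev (ρ K) x * (fluidGam m c (ev (ρ K) x) (evV (M K) x) - 1)

section

variable {m c : ℝ} {ρ : ScalarField 𝒯} {M : VectorField 𝒯}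

theorem continuousOn_fluidGam (hρ : ∀ K, ∀ x ∈ 𝒯.cell K, ev (ρ K) x ≠ 0) (K : Fin 𝒯.n) :
    ContinuousOn (fun x => fluidGam m c (ev (ρ K) x) (evV (M K) x)) (𝒯.cell K) := by
  have h1 : ContinuousOn (fun x => (m / ev (ρ K) x) • evV (M K) x) (𝒯.cell K) :=
    (continuousOn_const.div (continuous_ev _).continuousOn (hρ K)).smul
      (continuous_evV _).continuousOn
  exact (continuousOn_const.add ((continuousOn_dotProduct h1 h1).div_const _)).sqrt

theorem continuousOn_energyDensity (hρ : ∀ K, ∀ x ∈ 𝒯.cell K, ev (ρ K) x ≠ 0) (K : Fin 𝒯.n) :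
    ContinuousOn (fun x => ev (ρ K) x * (fluidGam m c (ev (ρ K) x) (evV (M K) x) - 1))
      (𝒯.cell K) :=
  (continuous_ev _).continuousOn.mul ((continuousOn_fluidGam hρ K).sub continuousOn_const)

theorem continuousOn_velocity (hρ : ∀ K, ∀ x ∈ 𝒯.cell K, ev (ρ K) x ≠ 0) (K : Fin 𝒯.n) :
    ContinuousOn (fun x => velocity m c (ev (ρ K) x) (evV (M K) x)) (𝒯.cell K) :=
  (continuousOn_const.div ((continuous_ev _).continuousOn.mul (continuousOn_fluidGam hρ K))
    fun x hx => mul_ne_zero (hρ K x hx) (fluidGam_pos _ _ _ _).ne').smul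
      (continuous_evV _).continuousOn

theorem continuousOn_potential (hc : 0 < c) (hρ : ∀ K, ∀ x ∈ 𝒯.cell K, ev (ρ K) x ≠ 0)
    (K : Fin 𝒯.n) :
    ContinuousOn (fun x => potential m c (ev (ρ K) x) (evV (M K) x)) (𝒯.cell K) :=
  ((continuousOn_fluidGam hρ K).sub continuousOn_const).sub
    ((continuousOn_dotProduct (continuous_evV _).continuousOn (continuous_evV _).continuousOn).div
      ((continuousOn_const.mul ((continuous_ev _).continuousOn.pow 2)).mul
        (continuousOn_fluidGam hρ K))
      fun x hx => mul_ne_zero (mul_ne_zero (by positivity) (pow_ne_zero 2 (hρ K x hx)))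
        (fluidGam_pos _ _ _ _).ne')

end

variable {m c T : ℝ} {ρ : ℝ → ScalarField 𝒯} {M : ℝ → VectorField 𝒯}

/-- At a fixed point the density is continuous in time and never zero, so by the intermediate value
theorem it keeps its sign. -/
theorem mul_ev_pos (hT : 0 ≤ T) (cρ : ACCurve ρ T)
    (hρ : ∀ t ∈ Icc 0 T, ∀ K, ∀ x ∈ 𝒯.cell K, ev (ρ t K) x ≠ 0) {s t : ℝ} (hs : s ∈ Icc 0 T)
    (ht : t ∈ Icc 0 T) {K : Fin 𝒯.n} {x : Space} (hx : x ∈ 𝒯.cell K) :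
    0 < ev (ρ s K) x * ev (ρ t K) x := by
  by_contra hn
  have hcont : ContinuousOn (fun r => ev (ρ r K) x) (uIcc s t) := by
    refine (cρ.ac_linear hT (evalS K x)).continuousOn.mono ?_
    rw [uIcc_of_le hT]
    exact (convex_Icc 0 T).ordConnected.uIcc_subset hs ht
  have h0 : (0 : ℝ) ∈ uIcc (ev (ρ s K) x) (ev (ρ t K) x) := by
    rw [mem_uIcc]
    rcases mul_nonpos_iff.1 (not_lt.1 hn) with h | h
    · exact Or.inr ⟨h.2, h.1⟩
    · exact Or.inl ⟨h.1, h.2⟩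
  obtain ⟨r, hr, hr0⟩ := intermediate_value_uIcc hcont h0
  exact hρ r ((convex_Icc 0 T).ordConnected.uIcc_subset hs ht hr) K x hx hr0

/-- The bound is uniform in the point and in both times. It gives the absolute continuity of the
fluid energy as well as the domination needed to differentiate under the integral. -/
theorem exists_energyDensity_bound (hm : 0 < m) (hc : 0 < c) (hT : 0 ≤ T) (cρ : ACCurve ρ T)
    (cM : ACCurve M T) (hρ : ∀ t ∈ Icc 0 T, ∀ K, ∀ x ∈ 𝒯.cell K, ev (ρ t K) x ≠ 0) :
    ∃ D, 0 ≤ D ∧ ∀ s ∈ Icc 0 T, ∀ t ∈ Icc 0 T, ∀ K, ∀ x ∈ 𝒯.cell K,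
      |ev (ρ s K) x * (fluidGam m c (ev (ρ s K) x) (evV (M s K) x) - 1) -
        ev (ρ t K) x * (fluidGam m c (ev (ρ t K) x) (evV (M t K) x) - 1)| ≤
      D * ∑ j : cρ.ι ⊕ cM.ι, |Sum.elim cρ.coef cM.coef j s - Sum.elim cρ.coef cM.coef j t| := by
  obtain ⟨A, hA, hA'⟩ := exists_bound_ev (𝒯 := 𝒯) fun K i => cρ.vec i K
  obtain ⟨B, hB, hB'⟩ := exists_bound_ev (𝒯 := 𝒯) fun K (i : cM.ι × Fin 3) => cM.vec i.1 K i.2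
  refine ⟨2 * A + c⁻¹ * (3 * B), by positivity, fun s hs t ht K x hx => ?_⟩
  refine (abs_energyDensity_sub_le hm hc (mul_ev_pos hT cρ hρ hs ht hx) _ _).trans ?_
  have h1 := abs_map_sub_le cρ (evalS K x) (fun i => hA' K i x hx) hs ht
  have h2 : ∀ j, |evV (M s K) x j - evV (M t K) x j| ≤ B * ∑ i, |cM.coef i s - cM.coef i t| :=
    fun j => abs_map_sub_le cM (evalV K x j) (fun i => hB' K (i, j) x hx) hs ht
  have h3 := Finset.sum_le_sum fun j (_ : j ∈ Finset.univ) => h2 j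
  rw [Finset.sum_const, Finset.card_univ, Fintype.card_fin, nsmul_eq_mul] at h3
  rw [Fintype.sum_sum_type]
  simp only [Sum.elim_inl, Sum.elim_inr]
  set a := ∑ i, |cρ.coef i s - cρ.coef i t|
  set b := ∑ i, |cM.coef i s - cM.coef i t|
  have ha : 0 ≤ a := Finset.sum_nonneg fun i _ => abs_nonneg _
  have hb : 0 ≤ b := Finset.sum_nonneg fun i _ => abs_nonneg _
  have hci : 0 < c⁻¹ := inv_pos.2 hc
  have h4 := mul_le_mul_of_nonneg_left h3 hci.le
  push_cast at h4
  -- A single constant multiplies both sums of increments; the resulting cross terms are nonnegative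
  -- and can be dropped.
  have h5 : 0 ≤ c⁻¹ * (3 * B) * a := by positivity
  have h6 : 0 ≤ 2 * A * b := by positivity
  change |ev (ρ s K) x - ev (ρ t K) x| ≤ A * a at h1
  nlinarith

theorem ac_fluidEnergy (hm : 0 < m) (hc : 0 < c) (hT : 0 ≤ T) (cρ : ACCurve ρ T)
    (cM : ACCurve M T) (hρ : ∀ t ∈ Icc 0 T, ∀ K, ∀ x ∈ 𝒯.cell K, ev (ρ t K) x ≠ 0) :
    AbsolutelyContinuousOnInterval (fun t => fluidEnergy m c (ρ t) (M t)) 0 T := by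
  obtain ⟨D, hD, H⟩ := exists_energyDensity_bound hm hc hT cρ cM hρ
  refine ac_of_dist_le (f := Sum.elim cρ.coef cM.coef)
    (∑ K, D * (volume : Measure Space).real (𝒯.cell K)) ?_ ?_
  · rintro (i | i)
    · exact cρ.ac i
    · exact cM.ac i
  · intro s hs t ht
    rw [uIcc_of_le hT] at hs ht
    rw [fluidEnergy, fluidEnergy, integral, integral, ← Finset.sum_sub_distrib, Finset.sum_mul]
    refine (Finset.abs_sum_le_sum_abs _ _).trans (Finset.sum_le_sum fun K _ => ?_)
    rw [← MeasureTheory.integral_sub (integrableOn_cell (continuousOn_energyDensity (hρ s hs) K))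
      (integrableOn_cell (continuousOn_energyDensity (hρ t ht) K))]
    have hle : ∀ x ∈ 𝒯.cell K, ‖ev (ρ s K) x * (fluidGam m c (ev (ρ s K) x) (evV (M s K) x) - 1) -
        ev (ρ t K) x * (fluidGam m c (ev (ρ t K) x) (evV (M t K) x) - 1)‖ ≤ _ :=
      fun x hx => H s hs t ht K x hx
    refine (norm_setIntegral_le_of_norm_le_const (𝒯.isCompact_cell K).measure_lt_top
      hle).trans (le_of_eq ?_)
    ring

theorem hasDerivAt_fluidEnergy (hm : 0 < m) (hc : 0 < c) (hT : 0 ≤ T) (cρ : ACCurve ρ T)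
    (cM : ACCurve M T) (hρ : ∀ t ∈ Icc 0 T, ∀ K, ∀ x ∈ 𝒯.cell K, ev (ρ t K) x ≠ 0) {t : ℝ}
    (h : cρ.Good t) (h' : cM.Good t) :
    HasDerivAt (fun t => fluidEnergy m c (ρ t) (M t))
      (𝒯.integral (fun K x =>
          potential m c (ev (ρ t K) x) (evV (M t K) x) * ev (cρ.deriv t K) x) +
        𝒯.integral (fun K x =>
          velocity m c (ev (ρ t K) x) (evV (M t K) x) ⬝ᵥ evV (cM.deriv t K) x) / c ^ 2) t := by
  obtain ⟨D, hD, H⟩ := exists_energyDensity_bound hm hc hT cρ cM hρ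
  have ht : t ∈ Icc 0 T := h.mem_Icc
  have hlip : ∃ B, ∀ᶠ s in 𝓝 t,
      ∑ j : cρ.ι ⊕ cM.ι, |Sum.elim cρ.coef cM.coef j s - Sum.elim cρ.coef cM.coef j t| ≤
        B * |s - t| := by
    have hd : ∀ j : cρ.ι ⊕ cM.ι, ∃ B, ∀ᶠ s in 𝓝 t,
        |Sum.elim cρ.coef cM.coef j s - Sum.elim cρ.coef cM.coef j t| ≤ B * |s - t| := by
      intro j
      have : DifferentiableAt ℝ (Sum.elim cρ.coef cM.coef j) t := by
        rcases j with i | i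
        · exact h.2 i
        · exact h'.2 i
      exact this.isBigO_sub.bound
    choose B hB using hd
    refine ⟨∑ j, B j, ?_⟩
    filter_upwards [eventually_all.2 hB] with s hs
    rw [Finset.sum_mul]
    exact Finset.sum_le_sum fun j _ => hs j
  obtain ⟨B, hB⟩ := hlip
  have hpot := fun K => continuousOn_potential (m := m) hc (M := M t) (hρ t ht) K
  have hvel := fun K => continuousOn_velocity (m := m) (c := c) (M := M t) (hρ t ht) K
  have hK : ∀ K, HasDerivAt
      (fun s => ∫ x in 𝒯.cell K,
        ev (ρ s K) x * (fluidGam m c (ev (ρ s K) x) (evV (M s K) x) - 1))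
      (∫ x in 𝒯.cell K, (ev (cρ.deriv t K) x * potential m c (ev (ρ t K) x) (evV (M t K) x) +
        (evV (cM.deriv t K) x ⬝ᵥ velocity m c (ev (ρ t K) x) (evV (M t K) x)) / c ^ 2)) t := by
    intro K
    refine hasDerivAt_integral_of_lip_at (C := D * B) (h.eventually.and hB)
      (fun s hs => (integrableOn_cell
        (continuousOn_energyDensity (hρ s hs.1) K)).aestronglyMeasurable)
      (integrableOn_cell (continuousOn_energyDensity (hρ t ht) K)) ?_ ?_ ?_
    · exact (integrableOn_cell (((continuous_ev _).continuousOn.mul (hpot K)).add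
        ((continuousOn_dotProduct (continuous_evV _).continuousOn (hvel K)).div_const
          _))).aestronglyMeasurable
    · refine (ae_restrict_iff' (𝒯.measurableSet_cell K)).2 (ae_of_all _ fun x hx s hs => ?_)
      rw [mul_assoc]
      exact (H s hs.1 t ht K x hx).trans (mul_le_mul_of_nonneg_left hs.2 hD)
    · refine (ae_restrict_iff' (𝒯.measurableSet_cell K)).2 (ae_of_all _ fun x hx => ?_)
      exact hasDerivAt_energyDensity hm hc (hρ t ht K x hx) (cρ.hasDerivAt_linear h (evalS K x))
        fun i => cM.hasDerivAt_linear h' (evalV K x i)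
  refine (HasDerivAt.fun_sum fun K (_ : K ∈ Finset.univ) => hK K).congr_deriv ?_
  refine (integral_add (F := fun K x => ev (cρ.deriv t K) x *
      potential m c (ev (ρ t K) x) (evV (M t K) x))
    (G := fun K x => (evV (cM.deriv t K) x ⬝ᵥ velocity m c (ev (ρ t K) x) (evV (M t K) x)) / c ^ 2)
    (fun K => (continuous_ev _).continuousOn.mul (hpot K)) fun K =>
      (continuousOn_dotProduct (continuous_evV _).continuousOn (hvel K)).div_const _).trans ?_
  simp only [div_eq_inv_mul]
  rw [integral_const_mul]
  simp only [mul_comm, dotProduct_comm]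

/-! ### Fluxes -/

/-- A test function that is single-valued on faces has no jump. Both `1` and the elements of `QZero`
are of this kind. -/
theorem densityFlux_eq_zero (M : VectorField 𝒯) (ρ : ScalarField 𝒯) (v : VectorField 𝒯)
    {φ : ScalarField 𝒯}
    (h : ∀ K L, ∀ x ∈ 𝒯.cell K, x ∈ 𝒯.cell L → ev (φ K) x = ev (φ L) x) :
    𝒯.densityFlux M ρ v φ = 0 := by
  refine Finset.sum_eq_zero fun e _ => setIntegral_eq_zero_of_forall_eq_zero fun x hx => ?_
  simp [h e.1 e.2 x hx.1 hx.2]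

theorem densityFlux_smul (M : VectorField 𝒯) (ρ : ScalarField 𝒯) (v : VectorField 𝒯)
    (φ : ScalarField 𝒯) (a : ℝ) :
    𝒯.densityFlux M ρ v (fun K => a • φ K) = 𝒯.densityFlux M ρ v φ * a := by
  simp only [densityFlux, faceSum, Finset.sum_mul, ← MeasureTheory.integral_mul_const]
  refine Finset.sum_congr rfl fun e _ => MeasureTheory.integral_congr_ae (ae_of_all _ fun x => ?_)
  simp only [ev_smul, mul_smul, ← smul_add, dotProduct_smul, smul_eq_mul]
  ring

theorem momentumFlux_self (M w : VectorField 𝒯) : 𝒯.momentumFlux M w w = 0 := by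
  refine Finset.sum_eq_zero fun e _ => setIntegral_eq_zero_of_forall_eq_zero fun x _ => ?_
  simp

end Mesh

/-! ### The equations of the scheme along the solution curves, and the invariants. -/

namespace Trajectory

open Mesh

variable {𝒯 : Mesh} {N k : ℕ} {S : Trajectory 𝒯 N} {m c e T : ℝ} {wt : Fin N → ℝ}

theorem dt_eq {f : ℝ → ScalarField 𝒯} (C : ACCurve f T) {t : ℝ} (h : C.Good t) (K : Fin 𝒯.n)
    (x : Space) : dt f t K x = ev (C.deriv t K) x :=
  (C.hasDerivAt_linear h (evalS K x)).deriv

theorem dtV_eq {f : ℝ → VectorField 𝒯} (C : ACCurve f T) {t : ℝ} (h : C.Good t) (K : Fin 𝒯.n)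
    (x : Space) : dtV f t K x = evV (C.deriv t K) x :=
  funext fun i => (C.hasDerivAt_linear h (evalV K x i)).deriv

/-- A coefficient of the divergence on a cell. -/
def coeffDiv (K : Fin 𝒯.n) (a : Fin 3 →₀ ℕ) : VectorField 𝒯 →ₗ[ℝ] ℝ where
  toFun f := (div (f K)).coeff a
  map_add' f g := by simp [div, Finset.sum_add_distrib]
  map_smul' r f := by simp [div, Finset.mul_sum, MvPolynomial.coeff_sum]

theorem energy_eq_add (S : Trajectory 𝒯 N) (m c : ℝ) (wt : Fin N → ℝ) (t : ℝ) :
    S.energy m c wt t =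
    c ^ 2 * fluidEnergy m c (S.ρ t) (S.M t) + ∑ p, (wt p * m * c ^ 2) * (gam m c (S.U p t) - 1)
      + 1 / (8 * Real.pi) * (innerV (S.E t) (S.E t) + innerV (S.B t) (S.B t)) := by
  rw [Trajectory.energy, fluidEnergy, ← Mesh.integral_const_mul (c ^ 2), innerV_apply, innerV_apply,
    ← Mesh.integral_add
      (fun K => continuousOn_dotProduct (continuous_evV _).continuousOn
        (continuous_evV _).continuousOn)
      fun K => continuousOn_dotProduct (continuous_evV _).continuousOn
        (continuous_evV _).continuousOn]
  congr 2
  · refine Mesh.integral_congr fun K x _ => mul_comm _ _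
  · exact Finset.sum_congr rfl fun p _ => by ring

namespace IsSolution

variable (hS : S.IsSolution k m c e wt T)

include hS

/-- The density as a curve. -/
def curveρ : ACCurve S.ρ T := scalarCurve (k + 1) hS.ac_ρ hS.mem_ρ

/-- The momentum as a curve. -/
def curveM : ACCurve S.M T :=
  vectorCurve (k + 1) hS.ac_M fun t ht => (hS.mem_M t ht).1.totalDegree_le

/-- The electric field as a curve. -/
def curveE : ACCurve S.E T :=
  vectorCurve (k + 1) hS.ac_E fun t ht => totalDegree_le_of_mem_NedZero (hS.mem_E t ht)

/-- The magnetic field as a curve. -/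
def curveB : ACCurve S.B T :=
  vectorCurve (k + 1) hS.ac_B fun t ht => (hS.mem_B t ht).1.totalDegree_le

theorem density_deriv {t : ℝ} (h : hS.curveρ.Good t) (heq : S.DensityEq k t) {φ : ScalarField 𝒯}
    (hφ : φ ∈ 𝒯.DG (k + 1)) :
    innerS (hS.curveρ.deriv t) φ =
      𝒯.integral (fun K x => ev (S.ρ t K) x * (evV (S.w t K) x ⬝ᵥ evV (grad (φ K)) x))
        - 𝒯.densityFlux (S.M t) (S.ρ t) (S.w t) φ := by
  rw [← heq φ hφ]
  simp only [dt_eq _ h]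
  rfl

theorem ampere_deriv {t : ℝ} (h : hS.curveE.Good t) (heq : S.AmpereEq k m c e wt t)
    {ν : VectorField 𝒯} (hν : ν ∈ 𝒯.NedZero k) :
    innerV (hS.curveE.deriv t) ν =
      c * 𝒯.integral (fun K x => evV (S.B t K) x ⬝ᵥ evV (curl (ν K)) x)
      - 4 * Real.pi * e / m *
        𝒯.integral (fun K x => ev (S.ρ t K) x * (evV (S.w t K) x ⬝ᵥ evV (ν K) x))
      - 4 * Real.pi * e / m *
        ∑ p, (wt p / gam m c (S.U p t)) * (S.U p t ⬝ᵥ S.atParticle ν p t) := by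
  rw [← heq ν hν]
  simp only [dtV_eq _ h]
  rfl

theorem faraday_deriv {t : ℝ} (h : hS.curveB.Good t) (heq : S.FaradayEq k c t)
    {τ : VectorField 𝒯} (hτ : τ ∈ 𝒯.RTZero k) :
    innerV (hS.curveB.deriv t) τ =
      - c * 𝒯.integral (fun K x => evV (τ K) x ⬝ᵥ evV (curl (S.E t K)) x) := by
  rw [← heq τ hτ]
  simp only [dtV_eq _ h]
  rfl

/-- With `w` as test field the two transport terms coincide, the first flux contains `w × w`, and `w
× B` is orthogonal to `w`. -/
theorem momentum_deriv {t : ℝ} (h : hS.curveM.Good t) (heq : S.MomentumEq k m c e t)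
    (hw : S.w t ∈ 𝒯.RT k) :
    innerV (hS.curveM.deriv t) (S.w t) =
      - 𝒯.integral (fun K x =>
        ev (S.ρ t K) x * (evV (S.w t K) x ⬝ᵥ evV (grad (S.P t K)) x)) * c ^ 2
      + e / m * 𝒯.integral (fun K x => ev (S.ρ t K) x * (evV (S.w t K) x ⬝ᵥ evV (S.E t K) x))
      + 𝒯.densityFlux (S.M t) (S.ρ t) (S.w t) (S.P t) * c ^ 2 := by
  have h1 := heq (S.w t) hw
  simp only [dtV_eq hS.curveM h, sub_self, zero_dotProduct, Mesh.integral_zero, momentumFlux_self,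
    add_dotProduct] at h1
  have h2 : ∀ u v : Fin 3 → ℝ, (u ⨯₃ v) ⬝ᵥ u = 0 := fun u v => by
    rw [dotProduct_comm, dot_self_cross]
  simp only [h2, add_zero, dotProduct_comm (evV (S.E t _) _)] at h1
  rw [innerV_apply, h1]
  ring

theorem ae_eqs (hT : 0 ≤ T) : ∀ᵐ t, t ∈ Icc 0 T →
    (hS.curveρ.Good t ∧ hS.curveM.Good t ∧ hS.curveE.Good t ∧ hS.curveB.Good t) ∧
    (S.DensityEq k t ∧ S.MomentumEq k m c e t ∧ S.AmpereEq k m c e wt t ∧ S.FaradayEq k c t) ∧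
    S.ParticleEq m c e t ∧ (∀ p i, DifferentiableAt ℝ (fun s => S.X p s i) t) ∧
    ∀ p i, DifferentiableAt ℝ (fun s => S.U p s i) t := by
  have hX : ∀ᵐ t : ℝ, ∀ p i, t ∈ uIcc 0 T → DifferentiableAt ℝ (fun s => S.X p s i) t :=
    ae_all_iff.2 fun p => ae_all_iff.2 fun i => (hS.ac_X p i).ae_differentiableAt
  have hU : ∀ᵐ t : ℝ, ∀ p i, t ∈ uIcc 0 T → DifferentiableAt ℝ (fun s => S.U p s i) t :=
    ae_all_iff.2 fun p => ae_all_iff.2 fun i => (hS.ac_U p i).ae_differentiableAt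
  rw [uIcc_of_le hT] at hX hU
  filter_upwards [hS.curveρ.ae_good hT, hS.curveM.ae_good hT, hS.curveE.ae_good hT,
    hS.curveB.ae_good hT, (ae_restrict_iff' measurableSet_Icc).1 hS.density,
    (ae_restrict_iff' measurableSet_Icc).1 hS.momentum,
    (ae_restrict_iff' measurableSet_Icc).1 hS.ampere,
    (ae_restrict_iff' measurableSet_Icc).1 hS.faraday,
    (ae_restrict_iff' measurableSet_Icc).1 hS.particle, hX, hU]
    with t h1 h2 h3 h4 h5 h6 h7 h8 h9 h10 h11 ht
  exact ⟨⟨h1 ht, h2 ht, h3 ht, h4 ht⟩, ⟨h5 ht, h6 ht, h7 ht, h8 ht⟩, h9 ht,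
    fun p i => h10 p i ht, fun p i => h11 p i ht⟩

/-! ### Mass -/

theorem fluidMass_eq (hT : 0 ≤ T) {t : ℝ} (ht : t ∈ Icc 0 T) : S.fluidMass t = S.fluidMass 0 := by
  have h1 : ∀ t, S.fluidMass t = (innerS (𝒯 := 𝒯)).flip (fun _ => 1) (S.ρ t) := fun t => by
    simp [fluidMass, innerS_apply]
  simp only [h1]
  refine ac_eq_of_ae_hasDerivAt_zero hT (hS.curveρ.ac_linear hT _) ?_ ht
  filter_upwards [hS.ae_eqs hT] with t h ht
  obtain ⟨⟨hρ, -⟩, ⟨hd, -⟩, -⟩ := h ht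
  refine (hS.curveρ.hasDerivAt_linear hρ _).congr_deriv ?_
  rw [LinearMap.flip_apply, hS.density_deriv hρ hd (fun K => by simp),
    densityFlux_eq_zero _ _ _ (by simp)]
  have : grad 1 = 0 := by ext1 i; simp [grad]
  simp [this, Mesh.integral_zero]

theorem particleMass_eq {t : ℝ} (ht : t ∈ Icc 0 T) : S.particleMass wt t = ∑ p, wt p :=
  Finset.sum_congr rfl fun p _ => indicator_of_mem (mem_iUnion.2 ⟨_, hS.mem_X t ht p⟩) _

/-! ### Energy -/

theorem ac_gam (hm : 0 < m) (hc : 0 < c) (p : Fin N) :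
    AbsolutelyContinuousOnInterval (fun t => gam m c (S.U p t)) 0 T :=
  ac_of_dist_le (m * c)⁻¹ (hS.ac_U p) fun _ _ _ _ => abs_gam_sub_gam_le hm hc _ _

theorem energy_deriv_eq_zero (hm : 0 < m) (hc : 0 < c) (hT : 0 ≤ T) {t : ℝ} (ht : t ∈ Icc 0 T)
    (hg : hS.curveρ.Good t ∧ hS.curveM.Good t ∧ hS.curveE.Good t ∧ hS.curveB.Good t)
    (heq : S.DensityEq k t ∧ S.MomentumEq k m c e t ∧ S.AmpereEq k m c e wt t ∧ S.FaradayEq k c t)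
    (hp : S.ParticleEq m c e t) (hU : ∀ p i, DifferentiableAt ℝ (fun s => S.U p s i) t) :
    HasDerivAt (S.energy m c wt) 0 t := by
  obtain ⟨gρ, gM, gE, gB⟩ := hg
  obtain ⟨eρ, eM, eE, eB⟩ := heq
  have hfl := hasDerivAt_fluidEnergy hm hc hT hS.curveρ hS.curveM hS.ρ_ne_zero gρ gM
  -- The time derivatives lie in the spaces onto which `P` and `w` are projected, so the exact
  -- `potential` and `velocity` may be exchanged for the projections.
  rw [← (hS.proj_P t ht).2 _ (hS.curveρ.deriv_mem gρ (𝒯.DGSub (k + 1)) hS.mem_ρ),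
    ← (hS.proj_w t ht).2 _ (hS.curveM.deriv_mem gM (𝒯.RTSub k) hS.mem_M)] at hfl
  have hpart : ∀ p, HasDerivAt (fun s => gam m c (S.U p s))
      (e / (m ^ 2 * c ^ 2 * gam m c (S.U p t)) * (S.U p t ⬝ᵥ S.atParticle (S.E t) p t)) t :=
    fun p => by
      refine (hasDerivAt_gam fun i => (hU p i).hasDerivAt).congr_deriv ?_
      simp only [(hp p).2]
      have : (fun i => e * (S.atParticle (S.E t) p t + (1 / (c * m * gam m c (S.U p t))) •
          (S.U p t ⨯₃ S.atParticle (S.B t) p t)) i) = e • (S.atParticle (S.E t) p t +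
          (1 / (c * m * gam m c (S.U p t))) • (S.U p t ⨯₃ S.atParticle (S.B t) p t)) := rfl
      rw [this, dotProduct_smul, dotProduct_add, dotProduct_smul, dot_self_cross]
      simp only [smul_eq_mul]
      ring
  have hE := hS.curveE.hasDerivAt_bilinear hS.curveE gE gE innerV
  have hB := hS.curveB.hasDerivAt_bilinear hS.curveB gB gB innerV
  have hall := ((hfl.const_mul (c ^ 2)).add (HasDerivAt.fun_sum fun p (_ : p ∈ Finset.univ) =>
    ((hpart p).sub_const 1).const_mul (wt p * m * c ^ 2))).add
      ((hE.add hB).const_mul (1 / (8 * Real.pi)))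
  rw [show S.energy m c wt = _ from funext (S.energy_eq_add m c wt)]
  refine hall.congr_deriv ?_
  have hP : 𝒯.integral (fun K x => ev (S.P t K) x * ev (hS.curveρ.deriv t K) x) =
      innerS (hS.curveρ.deriv t) (S.P t) := by
    simp only [innerS_apply, mul_comm]
  have hw : 𝒯.integral (fun K x => evV (S.w t K) x ⬝ᵥ evV (hS.curveM.deriv t K) x) =
      innerV (hS.curveM.deriv t) (S.w t) := innerV_comm _ _
  rw [hP, hw, hS.density_deriv gρ eρ (hS.proj_P t ht).1,
    hS.momentum_deriv gM eM (hS.proj_w t ht).1, innerV_comm (S.E t), innerV_comm (S.B t),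
    hS.ampere_deriv gE eE (hS.mem_E t ht), hS.faraday_deriv gB eB (hS.mem_B t ht)]
  have hsum : ∑ p, wt p * m * c ^ 2 * (e / (m ^ 2 * c ^ 2 * gam m c (S.U p t)) *
      (S.U p t ⬝ᵥ S.atParticle (S.E t) p t)) =
      e / m * ∑ p, (wt p / gam m c (S.U p t)) * (S.U p t ⬝ᵥ S.atParticle (S.E t) p t) := by
    rw [Finset.mul_sum]
    refine Finset.sum_congr rfl fun p _ => ?_
    have := (gam_pos m c (S.U p t)).ne'
    field_simp
  rw [hsum]
  have hπ := Real.pi_ne_zero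
  field_simp
  ring

theorem energy_eq (hm : 0 < m) (hc : 0 < c) (hT : 0 ≤ T) {t : ℝ} (ht : t ∈ Icc 0 T) :
    S.energy m c wt t = S.energy m c wt 0 := by
  refine ac_eq_of_ae_hasDerivAt_zero hT ?_ ?_ ht
  · rw [show S.energy m c wt = _ from funext (S.energy_eq_add m c wt)]
    exact (((ac_fluidEnergy hm hc hT hS.curveρ hS.curveM hS.ρ_ne_zero).const_mul _).fun_add
      (ac_sum _ fun p _ => ((hS.ac_gam hm hc p).fun_sub (ac_const 1)).const_mul _)).fun_add
      (((hS.curveE.ac_bilinear hS.curveE hT innerV).fun_add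
        (hS.curveB.ac_bilinear hS.curveB hT innerV)).const_mul _)
  · filter_upwards [hS.ae_eqs hT] with t h ht
    obtain ⟨hg, heq, hp, -, hU⟩ := h ht
    exact hS.energy_deriv_eq_zero hm hc hT ht hg heq hp hU

/-! ### Gauss's law -/

/-- A particle may change cells infinitely often; the Lipschitz bound across cells makes the choice
in `loc` irrelevant. -/
theorem ac_atParticleS {φ : ScalarField 𝒯} (hφ : φ ∈ 𝒯.QZero (k + 1)) (hT : 0 ≤ T) (p : Fin N) :
    AbsolutelyContinuousOnInterval (fun t => S.atParticleS φ p t) 0 T := by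
  obtain ⟨C, hC, h⟩ := hφ.2.exists_lipschitz
  refine ac_of_dist_le C (hS.ac_X p) fun s hs t ht => ?_
  rw [uIcc_of_le hT] at hs ht
  exact (h _ _ _ (hS.mem_X s hs p) _ (hS.mem_X t ht p)).trans
    (mul_le_mul_of_nonneg_left (euclidean_norm_le_sum_abs _) hC)

theorem ae_hasDerivAt_atParticleS {φ : ScalarField 𝒯} (hφ : φ ∈ 𝒯.QZero (k + 1)) (hT : 0 ≤ T)
    (p : Fin N) : ∀ᵐ t, t ∈ Icc 0 T → (∀ i, DifferentiableAt ℝ (fun s => S.X p s i) t) →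
      HasDerivAt (fun t => S.atParticleS φ p t)
        (S.atParticle (fun K => grad (φ K)) p t ⬝ᵥ fun i => _root_.deriv (fun s => S.X p s i) t)
        t := by
  filter_upwards [(hS.ac_atParticleS hφ hT p).ae_differentiableAt,
    ae_deriv_eq_of_branches (S.loc p) fun K s => ev (φ K) (S.X p s)] with t h1 h2 ht hX
  rw [uIcc_of_le hT] at h1
  exact (h1 ht).hasDerivAt.congr_deriv
    (h2 _ _ (h1 ht).hasDerivAt (hasDerivAt_ev_comp _ fun i => (hX i).hasDerivAt))

theorem gauss_eq (hm : 0 < m) (hT : 0 ≤ T) {D : ℝ → ScalarField 𝒯}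
    (hD : ∀ t ∈ Icc 0 T, 𝒯.IsWeakDiv k (S.E t) (D t)) {φ : ScalarField 𝒯}
    (hφ : φ ∈ 𝒯.QZero (k + 1)) {t : ℝ} (ht : t ∈ Icc 0 T) :
    S.gauss m e wt (D t) φ t = S.gauss m e wt (D 0) φ 0 := by
  -- No regularity in time is known for `D`. Its defining property replaces it by `-∫ E · ∇φ`, which
  -- is linear in `E`.
  let F : ℝ → ℝ := fun t => - innerV.flip (gradₗ φ) (S.E t) - 4 * Real.pi * e *
    (m⁻¹ * innerS.flip φ (S.ρ t) + ∑ p, wt p * S.atParticleS φ p t)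
  have hF : ∀ t ∈ Icc 0 T, S.gauss m e wt (D t) φ t = F t := fun t ht => by
    rw [gauss, (hD t ht).2 φ hφ]
    simp only [F, LinearMap.flip_apply, innerS_apply, innerV_apply]
    rw [← Mesh.integral_const_mul]
    simp only [div_eq_inv_mul, mul_assoc]
    rfl
  rw [hF t ht, hF 0 (left_mem_Icc.2 hT)]
  refine ac_eq_of_ae_hasDerivAt_zero hT ?_ ?_ ht
  · exact (hS.curveE.ac_linear hT _).fun_neg.fun_sub
      ((((hS.curveρ.ac_linear hT _).const_mul _).fun_add
        (ac_sum _ fun p _ => (hS.ac_atParticleS hφ hT p).const_mul _)).const_mul _)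
  · filter_upwards [hS.ae_eqs hT, ae_all_iff.2 (hS.ae_hasDerivAt_atParticleS hφ hT)] with t h hA ht
    obtain ⟨⟨gρ, -, gE, -⟩, ⟨eρ, -, eE, -⟩, hp, hX, -⟩ := h ht
    have hall := (hS.curveE.hasDerivAt_linear gE (innerV.flip (gradₗ φ))).neg.sub
      ((((hS.curveρ.hasDerivAt_linear gρ (innerS.flip φ)).const_mul m⁻¹).add
        (HasDerivAt.fun_sum fun p (_ : p ∈ Finset.univ) =>
          (hA p ht (hX p)).const_mul (wt p))).const_mul (4 * Real.pi * e))
    refine hall.congr_deriv ?_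
    rw [LinearMap.flip_apply, LinearMap.flip_apply,
      show (gradₗ φ : VectorField 𝒯) = fun K => grad (φ K) from rfl, hS.ampere_deriv gE eE (grad_mem_NedZero hφ),
      hS.density_deriv gρ eρ hφ.1, densityFlux_eq_zero _ _ _ fun K L x hK hL => hφ.2.ev_eq hK hL]
    simp only [curl_grad, evV_zero, dotProduct_zero, Mesh.integral_zero]
    -- The rate of change of the particle charge seen by `φ` is the particle current tested with
    -- `∇φ`; it cancels the source in Ampère's equation.
    have hsum : ∑ p, wt p * (S.atParticle (fun K => grad (φ K)) p t ⬝ᵥ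
        fun i => _root_.deriv (fun s => S.X p s i) t) =
        m⁻¹ * ∑ p, (wt p / gam m c (S.U p t)) *
          (S.U p t ⬝ᵥ S.atParticle (fun K => grad (φ K)) p t) := by
      rw [Finset.mul_sum]
      refine Finset.sum_congr rfl fun p _ => ?_
      have h1 : (fun i => _root_.deriv (fun s => S.X p s i) t) =
          (1 / (m * gam m c (S.U p t))) • S.U p t := by
        ext i
        rw [(hp p).1 i, Pi.smul_apply, smul_eq_mul, one_div_mul_eq_div]
      rw [h1, dotProduct_smul, dotProduct_comm, smul_eq_mul]
      have := (gam_pos m c (S.U p t)).ne'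
      field_simp
    rw [hsum]
    ring

/-! ### Divergence of the magnetic field -/

/-- Both `∂ₜB` and `curl E` lie in the test space, so Faraday's equation can be tested with `∂ₜB + c
curl E` itself, whose `L²` norm then vanishes. -/
theorem curveB_deriv_eq {t : ℝ} (ht : t ∈ Icc 0 T) (h : hS.curveB.Good t)
    (heq : S.FaradayEq k c t) :
    hS.curveB.deriv t = - c • (fun K => curl (S.E t K) : VectorField 𝒯) := by
  set R : VectorField 𝒯 := fun K => curl (S.E t K)
  have hR : R ∈ 𝒯.RTZeroSub k := curl_mem_RTZero (hS.mem_E t ht)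
  have hmem : hS.curveB.deriv t + c • R ∈ 𝒯.RTZeroSub k :=
    add_mem (hS.curveB.deriv_mem h (𝒯.RTZeroSub k) hS.mem_B) ((𝒯.RTZeroSub k).smul_mem c hR)
  have h1 := hS.faraday_deriv h heq hmem
  have h2 : innerV (hS.curveB.deriv t + c • R) (hS.curveB.deriv t + c • R) = 0 := by
    rw [LinearMap.map_add₂, h1, map_smul, LinearMap.smul_apply, innerV_comm R,
      innerV_apply, smul_eq_mul, neg_mul, neg_add_cancel]
  rw [neg_smul]
  exact eq_neg_of_add_eq_zero_left (eq_zero_of_innerV_self h2)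

/-- Linear functionals that vanish on curls of the electric space are constant along `B_h`. -/
theorem linear_B_eq (hT : 0 ≤ T) (ℓ : VectorField 𝒯 →ₗ[ℝ] ℝ)
    (hℓ : ∀ E ∈ 𝒯.NedZero k, ℓ (fun K => curl (E K)) = 0) {t : ℝ} (ht : t ∈ Icc 0 T) :
    ℓ (S.B t) = ℓ (S.B 0) := by
  refine ac_eq_of_ae_hasDerivAt_zero (F := fun t => ℓ (S.B t)) hT (hS.curveB.ac_linear hT ℓ) ?_ ht
  filter_upwards [hS.ae_eqs hT] with t h ht
  obtain ⟨⟨-, -, -, gB⟩, ⟨-, -, -, eB⟩, -⟩ := h ht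
  refine (hS.curveB.hasDerivAt_linear gB ℓ).congr_deriv ?_
  rw [hS.curveB_deriv_eq ht gB eB, map_smul, hℓ _ (hS.mem_E t ht), smul_zero]

theorem div_B_eq (hT : 0 ≤ T) {t : ℝ} (ht : t ∈ Icc 0 T) (K : Fin 𝒯.n) :
    div (S.B t K) = div (S.B 0 K) := by
  ext a
  refine hS.linear_B_eq hT (coeffDiv K a) (fun E _ => ?_) ht
  change (div (curl (E K))).coeff a = 0
  rw [div_curl, MvPolynomial.coeff_zero]

theorem hasWeakDivergence_B_iff (hT : 0 ≤ T) {t : ℝ} (ht : t ∈ Icc 0 T) (g : Space → ℝ) :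
    𝒯.HasWeakDivergence (S.B t) g ↔ 𝒯.HasWeakDivergence (S.B 0) g := by
  have h : ∀ ψ, IsTest ψ → 𝒯.integral (fun K x => evV (S.B t K) x ⬝ᵥ gradT ψ x) =
      𝒯.integral (fun K x => evV (S.B 0 K) x ⬝ᵥ gradT ψ x) := fun ψ hψ =>
    hS.linear_B_eq hT (pairGradT hψ) (fun E hE => integral_curl_dotProduct_gradT hE hψ) ht
  exact and_congr_right fun _ => forall_congr' fun ψ => forall_congr' fun hψ => by rw [h ψ hψ]

end IsSolution

end Trajectory

end HybridFluid

end

theorem mainTheorem4 (𝒯 : HybridFluid.Mesh) (k N : ℕ) (m c e : ℝ) (hm : 0 < m) (hc : 0 < c)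
    (wt : Fin N → ℝ) (T : ℝ) (hT : 0 ≤ T) (S : HybridFluid.Trajectory 𝒯 N)
    (hS : S.IsSolution k m c e wt T) :
    -- total fluid mass
    (∀ t ∈ Set.Icc 0 T, S.fluidMass t = S.fluidMass 0) ∧
    -- total particle mass
    (∀ t ∈ Set.Icc 0 T, S.particleMass wt t = ∑ p, wt p) ∧
    -- total energy
    (∀ t ∈ Set.Icc 0 T, S.energy m c wt t = S.energy m c wt 0) ∧
    -- weak Gauss law
    (∀ t ∈ Set.Icc 0 T, ∃! D, 𝒯.IsWeakDiv k (S.E t) D) ∧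
    (∀ D : ℝ → HybridFluid.ScalarField 𝒯, (∀ t ∈ Set.Icc 0 T, 𝒯.IsWeakDiv k (S.E t) (D t)) →
      ∀ φ ∈ 𝒯.QZero (k + 1), ∀ t ∈ Set.Icc 0 T,
        S.gauss m e wt (D t) φ t = S.gauss m e wt (D 0) φ 0) ∧
    -- divergence of the magnetic field, cell by cell and as the weak divergence in `Ω`
    (∀ t ∈ Set.Icc 0 T, ∀ K, HybridFluid.div (S.B t K) = HybridFluid.div (S.B 0 K)) ∧
    (∀ t ∈ Set.Icc 0 T, ∀ g, 𝒯.HasWeakDivergence (S.B t) g ↔ 𝒯.HasWeakDivergence (S.B 0) g) ∧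
    -- the flux terms vanish or cancel for the test functions `φ = 1`, `μ = w_h`, `φ = c² P_h`
    (∀ t ∈ Set.Icc 0 T,
      𝒯.densityFlux (S.M t) (S.ρ t) (S.w t) (fun _ => 1) = 0 ∧
      𝒯.momentumFlux (S.M t) (S.w t) (S.w t) = 0 ∧
      - 𝒯.densityFlux (S.M t) (S.ρ t) (S.w t) (fun K => c ^ 2 • S.P t K)
        + 𝒯.densityFlux (S.M t) (S.ρ t) (S.w t) (S.P t) * c ^ 2 = 0) := by
  refine ⟨fun t ht => hS.fluidMass_eq hT ht, fun t ht => hS.particleMass_eq ht,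
    fun t ht => hS.energy_eq hm hc hT ht,
    fun t _ => HybridFluid.Mesh.existsUnique_isWeakDiv (S.E t),
    fun D hD φ hφ t ht => hS.gauss_eq hm hT hD hφ ht, fun t ht K => hS.div_B_eq hT ht K,
    fun t ht g => hS.hasWeakDivergence_B_iff hT ht g, fun t _ => ⟨?_, ?_, ?_⟩⟩
  · exact HybridFluid.Mesh.densityFlux_eq_zero _ _ _ fun _ _ _ _ _ => rfl
  · exact HybridFluid.Mesh.momentumFlux_self _ _
  · rw [HybridFluid.Mesh.densityFlux_smul, neg_add_cancel]
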